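/- Let $\mathbb K=\mathbb R$ or $\mathbb C$, let $V$ be a finite-dimensional $\mathbb K$-vector space with a nondegenerate hermitian form $\langle-,-\rangle$ (symmetric if $\mathbb K=\mathbb R$) of arbitrary signature, and let $1\le m\le k$. Let $\mathrm{Gr}^0_{\mathbb K}(k,V)$ be the set of $k$-dimensional subspaces of $V$ on which the form is nondegenerate, with the topology and smooth structure induced from linearly independent $k$-frames. For $p\in\mathrm{Gr}^0_{\mathbb K}(k,V)$ identify $$T_p\,\mathrm{Gr}^0_{\mathbb K}(k,V)=\mathrm{Lin}_{\mathbb K}(p,p^\perp)\subset\mathrm{Lin}_{\mathbb K}(V,V)$$ by means of $V=p\oplus p^\perp$, and for $t\in \mathrm{Lin}_{\mathbb K}(V,V)$ let $t_p=\pi[p]\,t\,\pi'[p]$, where $\pi'[p]$ and $\pi[p]$ are the orthogonal projectors onto $p$ and $p^\perp$. Equip $\mathrm{Gr}^0_{\mathbb K}(k,V)$ with the hermitian metric $\langle s,t\rangle=\operatorname{tr}(s^*t)$, the pseudo-riemannian metric $\operatorname{Re}\langle s,t\rangle$, and the connection $$\nabla_tX(p)=\Big(\tfrac{d}{d\varepsilon}\Big|_{\varepsilon=0}X\big((1+\varepsilon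 t)p\big)\Big)_p .$$ Equip $\bigwedge^mV$ with the form $\langle v_1\wedge\dots\wedge v_m,w_1\wedge\dots\wedge w_m\rangle=\det\langle v_i,w_j\rangle$, and let $E^m:p\mapsto\bigwedge^mp$ be the $m$-Plücker map; its differential at $p$ is again denoted by $E^m$. Then the form on $\bigwedge^mV$ is hermitian and nondegenerate, and $E^m$ maps $\mathrm{Gr}^0_{\mathbb K}(k,V)$ injectively and homeomorphically onto its image into $\mathrm{Gr}^0_{\mathbb K}\big(\binom km,\bigwedge^mV\big)$. For every $p\in\mathrm{Gr}^0_{\mathbb K}(k,V)$: 1. the metric on $T_p\,\mathrm{Gr}^0_{\mathbb K}(k,V)$ is nondegenerate, and $\langle E^ms,E^mt\rangle=\binom{k-1}{m-1}\langle s,t\rangle$ for all tangent vectors $s,t$ at $p$; 2. there is exactly one $\mathbb R$-bilinear map $B$ from pairs of tangent vectors at $p$ to the normal space $\big(E^mT_p\,\mathrm{Gr}^0_{\mathbb K}(k,V)\big)^\perp$ (the second fundamental form of $E^m$ at $p$) such that, for every smooth tangent field $X$ on a neighbourhood of $p$, every smooth tangent field $Y$ on an open subset of $\mathrm{Gr}^0_{\mathbb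 K}\big(\binom km,\bigwedge^mV\big)$ with $Y(E^mq)=E^m(X(q))$ for $q$ in that neighbourhood, and every $t\in T_p\,\mathrm{Gr}^0_{\mathbb K}(k,V)$, $$\nabla_{E^mt}Y-B\big(t,X(p)\big)\in E^mT_p\,\mathrm{Gr}^0_{\mathbb K}(k,V);$$ 3. the $m$-Plücker embedding is minimal: the trace of $B$ with respect to the metric vanishes, that is, $\sum_iB(b_i,b_i')=0$ for all real bases $(b_i)$, $(b_i')$ of $T_p\,\mathrm{Gr}^0_{\mathbb K}(k,V)$ with $\operatorname{Re}\langle b_i,b_j'\rangle=\delta_{ij}$. In particular, $\sum_i\varepsilon_iB(b_i,b_i)=0$ for every real basis with $\operatorname{Re}\langle b_i,b_j\rangle=\varepsilon_i\delta_{ij}$, $\varepsilon_i=\pm1$. -/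

import Mathlib

open scoped ContDiff ComplexConjugate

noncomputable section

namespace Plucker

/-! ### Hermitian spaces

`K` is `ℝ` or `ℂ`.  A form `h` on `V` is conjugate-linear in the first variable and linear in the
second one; for `K = ℝ` it is bilinear. -/

section Form

variable {K V : Type*} [RCLike K] [AddCommGroup V] [Module K V]

/-- `h` is a nondegenerate hermitian form (symmetric if `K = ℝ`), of arbitrary signature. -/
structure IsHermitianForm (h : V →ₗ⋆[K] V →ₗ[K] K) : Prop where
  conj_symm : ∀ x y, conj (h x y) = h y x
  nondegenerate : ∀ x, (∀ y, h x y = 0) → x = 0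

/-- The nondegenerate piece of the grassmannian: the `k`-dimensional subspaces of `V` on which
the form `h` restricts to a nondegenerate form. -/
def Gr0 (h : V →ₗ⋆[K] V →ₗ[K] K) (k : ℕ) : Set (Submodule K V) :=
  {p | Module.finrank K p = k ∧ ∀ x ∈ p, (∀ y ∈ p, h x y = 0) → x = 0}

/-- The orthogonal complement of `p`. -/
def perp (h : V →ₗ⋆[K] V →ₗ[K] K) (p : Submodule K V) : Submodule K V :=
  p.orthogonalBilin h

open Classical in
/-- The orthogonal projector of `V = p ⊕ p^⊥` onto `p`
(meaningful when `p` is complementary to `p^⊥`, i.e. when `p` is nondegenerate). -/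
def proj (h : V →ₗ⋆[K] V →ₗ[K] K) (p : Submodule K V) : V →ₗ[K] V :=
  if hc : IsCompl p (perp h p) then p.projection (perp h p) hc else 0

/-- The tangent vector `t_p` at `p` given by an endomorphism `t`: project orthogonally to `p`,
apply `t`, project orthogonally to `p^⊥`. -/
def compress (h : V →ₗ⋆[K] V →ₗ[K] K) (p : Submodule K V) (t : V →ₗ[K] V) : V →ₗ[K] V :=
  (LinearMap.id - proj h p) ∘ₗ t ∘ₗ proj h p

/-- The tangent space at `p`: `Lin(p, p^⊥)` considered inside `Lin(V, V)` by means of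
`V = p ⊕ p^⊥`, i.e. the endomorphisms that kill `p^⊥` and take values in `p^⊥`. -/
def tangent (h : V →ₗ⋆[K] V →ₗ[K] K) (p : Submodule K V) : Submodule K (V →ₗ[K] V) where
  carrier := {t | (∀ x ∈ perp h p, t x = 0) ∧ ∀ x, t x ∈ perp h p}
  zero_mem' := ⟨fun _ _ => rfl, fun _ => (perp h p).zero_mem⟩
  add_mem' {s t} hs ht :=
    ⟨fun x hx => by rw [LinearMap.add_apply, hs.1 x hx, ht.1 x hx, add_zero],
      fun x => (perp h p).add_mem (hs.2 x) (ht.2 x)⟩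
  smul_mem' c t ht :=
    ⟨fun x hx => by rw [LinearMap.smul_apply, ht.1 x hx, smul_zero],
      fun x => (perp h p).smul_mem c (ht.2 x)⟩

open Classical in
/-- The adjoint `t^*` of `t` with respect to `h`, i.e. `h (t x) y = h x (t^* y)`
(it exists and is unique when `V` is finite-dimensional and `h` is nondegenerate). -/
def adj (h : V →ₗ⋆[K] V →ₗ[K] K) (t : V →ₗ[K] V) : V →ₗ[K] V :=
  if ht : ∃ s : V →ₗ[K] V, ∀ x y, h (t x) y = h x (s y) then ht.choose else 0

/-- The hermitian metric `⟨s, t⟩ = tr (s^* t)` on tangent vectors of the grassmannian. -/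
def hermitianMetric (h : V →ₗ⋆[K] V →ₗ[K] K) (s t : V →ₗ[K] V) : K :=
  LinearMap.trace K V (adj h s ∘ₗ t)

/-- The (pseudo-)riemannian metric on tangent vectors: the real part of the hermitian one. -/
def metric (h : V →ₗ⋆[K] V →ₗ[K] K) (s t : V →ₗ[K] V) : ℝ :=
  RCLike.re (hermitianMetric h s t)

end Form

/-! ### Topology and smoothness on the grassmannian, the connection

The grassmannian is the quotient of the open set of linearly independent `k`-frames (equivalently,
of the monomorphisms `K^k → V`) by `GL_k(K)`, so that functions on it are `GL_k(K)`-invariant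
functions of frames.  Frames are written in the coordinates of a basis of `V`; the notions below
do not depend on its choice. -/

section Smooth

variable {K V : Type*} [RCLike K] [AddCommGroup V] [Module K V] [FiniteDimensional K V]

/-- The `k`-tuple of vectors with the given coordinates. -/
def frame (V : Type*) [AddCommGroup V] [Module K V] [FiniteDimensional K V] {k : ℕ}
    (A : Fin k → Fin (Module.finrank K V) → K) (i : Fin k) : V :=
  ∑ j, A i j • Module.finBasis K V j

/-- The coordinates of the `k`-frames that span a member of `O`. -/
def framesOver (k : ℕ) (O : Set (Submodule K V)) :
    Set (Fin k → Fin (Module.finrank K V) → K) :=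
  {A | LinearIndependent K (frame V A) ∧ Submodule.span K (Set.range (frame V A)) ∈ O}

/-- A set `O` of `k`-dimensional subspaces is open in the grassmannian (quotient topology). -/
def IsOpenGr (k : ℕ) (O : Set (Submodule K V)) : Prop :=
  IsOpen (framesOver k O)

/-- `X` is a smooth tangent vector field on the open subset `O` of `Gr^0(k, V)`
(a lifted field, smooth as a function of frames). -/
structure IsTangentField (h : V →ₗ⋆[K] V →ₗ[K] K) (k : ℕ) (O : Set (Submodule K V))
    (X : Submodule K V → V →ₗ[K] V) : Prop where
  subset : O ⊆ Gr0 h k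
  isOpen : IsOpenGr k O
  mem_tangent : ∀ q ∈ O, X q ∈ tangent h q
  smooth : ∀ (v : V) (l : V →ₗ[K] K), ContDiffOn ℝ ∞
    (fun A : Fin k → Fin (Module.finrank K V) → K =>
      l (X (Submodule.span K (Set.range (frame V A))) v)) (framesOver k O)

/-- The derivative at `0` of a curve in a finite-dimensional space. -/
def velocity (c : ℝ → V) : V :=
  ∑ i, deriv (fun ε : ℝ => (Module.finBasis K V).repr (c ε) i) 0 • Module.finBasis K V i

/-- The connection on `Gr^0(k, V)`: the derivative at `ε = 0` of the field `X`, considered as an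
`End(V)`-valued function, along the curve `(1 + ε t) p`, projected to the tangent space at `p`. -/
def nabla (h : V →ₗ⋆[K] V →ₗ[K] K) (p : Submodule K V) (t : V →ₗ[K] V)
    (X : Submodule K V → V →ₗ[K] V) : V →ₗ[K] V :=
  compress h p (velocity (K := K) fun ε : ℝ => X (p.map (LinearMap.id + (ε : K) • t)))

end Smooth

/-! ### The exterior power of a hermitian space -/

section Wedge

variable {K V : Type*} [RCLike K] [AddCommGroup V] [Module K V]

/-- The `K`-module `N` with the action of scalars twisted by the conjugation. -/
def Twist (N : Type*) : Type _ := N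

instance (N : Type*) [AddCommGroup N] : AddCommGroup (Twist N) := inferInstanceAs (AddCommGroup N)

instance (N : Type*) [AddCommGroup N] [Module K N] : Module K (Twist N) :=
  Module.compHom N (starRingEnd K)

/-- `v_1, …, v_m ↦ ⟨v_1 ∧ ⋯ ∧ v_m, - ⟩`, a conjugate-linear alternating map. -/
def wedgeFormAux (h : V →ₗ⋆[K] V →ₗ[K] K) (m : ℕ) :
    V [⋀^Fin m]→ₗ[K] Twist (Module.Dual K (⋀[K]^m V)) where
  toFun v := exteriorPower.alternatingMapToDual K V m fun i => h (v i)
  map_update_add' v i x y := by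
    have e : ∀ z : V, (fun j => h (Function.update v i z j)) =
        Function.update (fun j => h (v j)) i (h z) := fun z => by
      funext j; by_cases hj : j = i <;> [(subst hj; simp); simp [hj]]
    have := (exteriorPower.alternatingMapToDual K V m).map_update_add (fun j => h (v j)) i
      (h x) (h y)
    simp only [← map_add, ← e] at this
    exact this
  map_update_smul' v i c x := by
    have e : ∀ z : V, (fun j => h (Function.update v i z j)) =
        Function.update (fun j => h (v j)) i (h z) := fun z => by
      funext j; by_cases hj : j = i <;> [(subst hj; simp); simp [hj]]
    have := (exteriorPower.alternatingMapToDual K V m).map_update_smul (fun j => h (v j)) i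
      (conj c) (h x)
    rw [← LinearMap.map_smulₛₗ, ← e, ← e] at this
    exact this
  map_eq_zero_of_eq' v i j hij hne :=
    (exteriorPower.alternatingMapToDual K V m).map_eq_zero_of_eq _ (congrArg h hij) hne

/-- The hermitian form on the exterior power `⋀^m V` given by
`⟨v_1 ∧ ⋯ ∧ v_m, w_1 ∧ ⋯ ∧ w_m⟩ = det ⟨v_i, w_j⟩`. -/
def wedgeForm (h : V →ₗ⋆[K] V →ₗ[K] K) (m : ℕ) : ⋀[K]^m V →ₗ⋆[K] ⋀[K]^m V →ₗ[K] K where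
  toFun := exteriorPower.alternatingMapLinearEquiv (wedgeFormAux h m)
  map_add' x y := map_add (exteriorPower.alternatingMapLinearEquiv (wedgeFormAux h m)) x y
  map_smul' c x := map_smul (exteriorPower.alternatingMapLinearEquiv (wedgeFormAux h m)) c x

theorem wedgeForm_ιMulti (h : V →ₗ⋆[K] V →ₗ[K] K) (m : ℕ) (v w : Fin m → V) :
    wedgeForm h m (exteriorPower.ιMulti K m v) (exteriorPower.ιMulti K m w) =
      (Matrix.of fun i j => h (v i) (w j)).det := by
  have : wedgeForm h m (exteriorPower.ιMulti K m v) =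
      exteriorPower.alternatingMapToDual K V m fun i => h (v i) :=
    exteriorPower.alternatingMapLinearEquiv_apply_ιMulti (wedgeFormAux h m) v
  rw [this, exteriorPower.alternatingMapToDual_apply_ιMulti, ← Matrix.det_transpose]
  rfl

/-! ### The `m`-Plücker map, its differential and its second fundamental form -/

/-- The `m`-Plücker map `p ↦ ⋀^m p`, where `⋀^m p` is considered as a subspace of `⋀^m V`. -/
def plucker (m : ℕ) (p : Submodule K V) : Submodule K (⋀[K]^m V) :=
  LinearMap.range (exteriorPower.map m p.subtype)

variable [FiniteDimensional K V]

/-- The differential of the `m`-Plücker map at `p` applied to `t`.  The curve `(1 + ε t) p` is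
sent to the curve `⋀^m (1 + ε t) (⋀^m p)`, whose velocity at `ε = 0` is the restriction to `⋀^m p`,
taken modulo `⋀^m p`, of the derivative of `⋀^m (1 + ε t)`. -/
def dPlucker (h : V →ₗ⋆[K] V →ₗ[K] K) (m : ℕ) (p : Submodule K V) (t : V →ₗ[K] V) :
    ⋀[K]^m V →ₗ[K] ⋀[K]^m V :=
  compress (wedgeForm h m) (plucker m p)
    (velocity (K := K) fun ε : ℝ => exteriorPower.map m (LinearMap.id + (ε : K) • t))

variable [Module ℝ V] [IsScalarTower ℝ K V]

/-- `B` is the second fundamental form at `p` of the `m`-Plücker map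
`Gr^0(k, V) → Gr^0(k.choose m, ⋀^m V)`: it takes values in the normal space and, whenever a tangent
field `Y` of the ambient grassmannian extends the image of a tangent field `X` defined near `p`,
`B t (X p)` is the normal component of the covariant derivative of `Y` in the direction of the
image of `t`. -/
structure IsSecondFundamentalForm (h : V →ₗ⋆[K] V →ₗ[K] K) (k m : ℕ) (p : Submodule K V)
    (B : tangent h p →ₗ[ℝ] tangent h p →ₗ[ℝ] (⋀[K]^m V →ₗ[K] ⋀[K]^m V)) : Prop where
  mem_tangent : ∀ t s, B t s ∈ tangent (wedgeForm h m) (plucker m p)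
  normal : ∀ t s r : tangent h p, metric (wedgeForm h m) (dPlucker h m p r) (B t s) = 0
  gauss_formula : ∀ (O : Set (Submodule K V)) (X : Submodule K V → V →ₗ[K] V)
    (O' : Set (Submodule K (⋀[K]^m V))) (Y : Submodule K (⋀[K]^m V) → ⋀[K]^m V →ₗ[K] ⋀[K]^m V),
    IsTangentField h k O X → IsTangentField (wedgeForm h m) (k.choose m) O' Y → p ∈ O →
    (∀ q ∈ O, plucker m q ∈ O' ∧ Y (plucker m q) = dPlucker h m q (X q)) →
    ∀ t s : tangent h p, X p = s →
      ∃ r : tangent h p, nabla (wedgeForm h m) (plucker m p) (dPlucker h m p t) Y =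
        dPlucker h m p r + B t s

/-- The trace of `B` with respect to the (pseudo-)riemannian metric on the tangent space at `p`
vanishes; it is computed by means of dual bases (e.g. `b'_i = ± b_i` if the basis `b` is
orthonormal). -/
def TraceVanishes {N : Type*} [AddCommMonoid N] [Module ℝ N] (h : V →ₗ⋆[K] V →ₗ[K] K)
    (p : Submodule K V) (B : tangent h p →ₗ[ℝ] tangent h p →ₗ[ℝ] N) : Prop :=
  ∀ (d : ℕ) (b b' : Module.Basis (Fin d) ℝ (tangent h p)),
    (∀ i j, metric h (b i) (b' j) = if i = j then 1 else 0) → ∑ i, B (b i) (b' i) = 0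

end Wedge

end Plucker

end

/-! Write `π` for the orthogonal projector onto `p` and `D(s)` for the derivation of `⋀^m V`
extending an endomorphism `s` (`derivation`). Everything rests on three properties of `D`: `[D(a),
D(b)] = D([a, b])` (`derivation_comm`), `D(s)^* = D(s^*)` (`adj_derivation`), and the trace of
`D(u)` on an exterior power of a `k`-dimensional space is `(k-1 choose m-1) tr u`
(`trace_derivation`). The orthogonal projector onto `⋀^m p` is `⋀^m π` (`proj_plucker`), and for
tangent `t` the differential of the Plücker map is `D(t) ∘ ⋀^m π`.

Metric: `D(s^*)` kills `⋀^m p`, so there `D(s^*) D(t)` equals `D([s^*, t])`; compressed to `⋀^m p`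
this is `D(s^* t)`, whose trace carries the constant. The same trace formula, paired with matrix
units, recovers `π` linearly from `⋀^m π`. Since the topology is that of the projectors, this gives
injectivity and continuity of the inverse.

Second fundamental form: on vectors `w` moving in `⋀^m q`, the field `Y` acts as `D(X(q))`.
Differentiating this identity yields a tangential part `D` of `∇X` and the remainder `D(X) D(t)` on
`⋀^m p` (`gauss_formula`). Grade `⋀^m V` by the number of factors in `p^⊥`: the remainder lands in
degree 2, the image of the differential in degree 1, hence the remainder is normal.

Minimality: for a rank-one tangent vector `u = φ ⊗ f` one has `D(u)^2 = 0`, because `u^2 = 0` and `f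
∧ f = 0`. The inverse of the metric is a real combination of squares of such `u`
(`exists_rank_one_family`), so the trace of `B` is a combination of the vanishing values `B(u, u)`.
-/

namespace Plucker

/-! ### Calculus of curves in finite-dimensional spaces that carry no norm -/

section Velocity

variable {K V W : Type*} [RCLike K] [AddCommGroup V] [Module K V] [FiniteDimensional K V]
  [AddCommGroup W] [Module K W] [FiniteDimensional K W]

/-- Expanding every argument in the standard basis exhibits `f` as a polynomial in the coordinates.
-/
theorem continuous_multilinearMap_pi {ι κ : Type*} [Fintype ι] [Fintype κ]
    (f : MultilinearMap K (fun _ : ι => κ → K) K) : Continuous f := by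
  classical
  have e : ∀ x : ι → κ → K,
      f x = ∑ J : ι → κ, (∏ i, x i (J i)) • f (fun i => Pi.single (J i) 1) := by
    intro x
    have hx : x = fun i => ∑ j, x i j • (Pi.single j 1 : κ → K) := by
      funext i
      exact pi_eq_sum_univ' (x i)
    conv_lhs => rw [hx, MultilinearMap.map_sum]
    exact Finset.sum_congr rfl fun J _ => f.map_smul_univ _ _
  have e' : (f : (ι → κ → K) → K) =
      fun x => ∑ J : ι → κ, (∏ i, x i (J i)) • f (fun i => Pi.single (J i) 1) := funext e
  rw [e']
  fun_prop

/-- `c` has the derivative `v` at `0` (a finite-dimensional space carries no norm here, so this is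
expressed by means of linear functionals). -/
def HasVelocity (K : Type*) {V : Type*} [RCLike K] [AddCommGroup V] [Module K V] (c : ℝ → V)
    (v : V) : Prop :=
  ∀ l : V →ₗ[K] K, HasDerivAt (fun ε => l (c ε)) (l v) 0

theorem HasVelocity.velocity_eq {c : ℝ → V} {v : V} (hc : HasVelocity K c v) :
    velocity (K := K) c = v := by
  have : ∀ i, deriv (fun ε : ℝ => (Module.finBasis K V).repr (c ε) i) 0 =
      (Module.finBasis K V).repr v i := fun i => (hc ((Module.finBasis K V).coord i)).deriv
  simp only [velocity, this, Module.Basis.sum_repr]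

theorem HasVelocity.unique {c : ℝ → V} {v w : V} (hv : HasVelocity K c v)
    (hw : HasVelocity K c w) : v = w :=
  hv.velocity_eq.symm.trans hw.velocity_eq

omit [FiniteDimensional K V] [FiniteDimensional K W] in
theorem linearMap_apply_eq_sum {ι : Type*} [Fintype ι] (b : Module.Basis ι K V) (T : V →ₗ[K] W)
    (x : V) : T x = ∑ i, b.repr x i • T (b i) := by
  conv_lhs => rw [← b.sum_repr x]
  simp only [map_sum, map_smul]

omit [FiniteDimensional K V] in
theorem HasVelocity.of_basis {ι : Type*} [Fintype ι] (b : Module.Basis ι K V) {c : ℝ → V} {v : V}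
    (hc : ∀ i, HasDerivAt (fun ε => b.repr (c ε) i) (b.repr v i) 0) : HasVelocity K c v := by
  intro l
  have e : (fun ε => l (c ε)) = fun ε => ∑ i, b.repr (c ε) i • l (b i) :=
    funext fun ε => linearMap_apply_eq_sum b l (c ε)
  rw [e, linearMap_apply_eq_sum b l v]
  exact HasDerivAt.fun_sum fun i _ => (hc i).mul_const _

/-- `velocity` is assembled from coordinatewise `deriv`, with default value 0; scalar
differentiability is what makes it a genuine derivative. -/
theorem hasVelocity_velocity {c : ℝ → V}
    (hc : ∀ l : V →ₗ[K] K, DifferentiableAt ℝ (fun ε => l (c ε)) 0) :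
    HasVelocity K c (velocity (K := K) c) := by
  refine HasVelocity.of_basis (Module.finBasis K V) fun i => ?_
  have : (Module.finBasis K V).repr (velocity (K := K) c) i =
      deriv (fun ε : ℝ => (Module.finBasis K V).repr (c ε) i) 0 := by
    simp [velocity, Finsupp.single_apply]
  rw [this]
  exact (hc ((Module.finBasis K V).coord i)).hasDerivAt

omit [FiniteDimensional K V] [FiniteDimensional K W] in
theorem HasVelocity.map {c : ℝ → V} {v : V} (hc : HasVelocity K c v) (T : V →ₗ[K] W) :
    HasVelocity K (fun ε => T (c ε)) (T v) := fun l => hc (l ∘ₗ T)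

omit [FiniteDimensional K V] in
theorem HasVelocity.congr {c d : ℝ → V} {v : V} (hc : HasVelocity K c v)
    (h : ∀ᶠ ε in nhds (0 : ℝ), d ε = c ε) : HasVelocity K d v := fun l =>
  (hc l).congr_of_eventuallyEq (h.mono fun ε hε => by simp only [hε])

omit [FiniteDimensional K V] in
theorem hasVelocity_affine (v u : V) : HasVelocity K (fun ε : ℝ => v + (ε : K) • u) u := fun l => by
  have h1 : HasDerivAt (fun ε : ℝ => (ε : K)) 1 0 := by
    simpa using (RCLike.ofRealCLM (K := K)).hasDerivAt (x := (0 : ℝ))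
  simpa using (h1.mul_const (l u)).const_add (l v)

-- The product rule for a moving operator on a moving vector, reduced to scalars by expanding the
-- vector in a basis.
omit [FiniteDimensional K V] in
theorem HasVelocity.apply {A : ℝ → W →ₗ[K] V} {A' : W →ₗ[K] V} (hA : HasVelocity K A A')
    {w : ℝ → W} {w' : W} (hw : HasVelocity K w w') :
    HasVelocity K (fun ε => A ε (w ε)) (A' (w 0) + A 0 w') := by
  intro l
  set b := Module.finBasis K W
  have e : ∀ (T : W →ₗ[K] V) (x : W), l (T x) = ∑ i, b.repr x i * l (T (b i)) := fun T x =>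
    linearMap_apply_eq_sum b (l ∘ₗ T) x
  have h1 : ∀ i, HasDerivAt (fun ε => l (A ε (b i))) (l (A' (b i))) 0 := fun i =>
    hA (l ∘ₗ LinearMap.applyₗ (b i))
  have h2 : ∀ i, HasDerivAt (fun ε => b.repr (w ε) i) (b.repr w' i) 0 := fun i => hw (b.coord i)
  have e' : (fun ε => l (A ε (w ε))) = fun ε => ∑ i, b.repr (w ε) i * l (A ε (b i)) :=
    funext fun ε => e _ _
  rw [map_add, e, e, add_comm, ← Finset.sum_add_distrib, e']
  exact HasDerivAt.fun_sum fun i _ => (h2 i).mul (h1 i)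

-- Since `T = ∑ b_j^* ⊗ T(b_j)`, every functional of an operator is a sum of functionals of its
-- values on a basis.
omit [FiniteDimensional K V] in
theorem HasVelocity.of_apply {A : ℝ → W →ₗ[K] V} {A' : W →ₗ[K] V}
    (hA : ∀ x, HasVelocity K (fun ε => A ε x) (A' x)) : HasVelocity K A A' := by
  intro l
  set b := Module.finBasis K W
  have e : ∀ T : W →ₗ[K] V, l T = ∑ j, (l ∘ₗ LinearMap.smulRightₗ (b.coord j)) (T (b j)) := by
    intro T
    have : T = ∑ j, (b.coord j).smulRight (T (b j)) := LinearMap.ext fun x => by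
      simpa using linearMap_apply_eq_sum b T x
    conv_lhs => rw [this, map_sum]
    rfl
  rw [e, funext fun ε => e (A ε)]
  exact HasDerivAt.fun_sum fun j _ => hA (b j) _

theorem hasVelocity_velocity_of_apply {A : ℝ → V →ₗ[K] W}
    (hA : ∀ (v : V) (l : W →ₗ[K] K), DifferentiableAt ℝ (fun ε => l (A ε v)) 0) :
    HasVelocity K A (velocity (K := K) A) := by
  refine hasVelocity_velocity fun l => ?_
  have := HasVelocity.of_apply (K := K) (A := A) (A' := (Module.finBasis K V).constr K fun i =>
    velocity (K := K) fun ε => A ε (Module.finBasis K V i)) fun x => by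
      intro l
      have e : (fun ε => l (A ε x)) = fun ε => ∑ i, (Module.finBasis K V).repr x i *
          l (A ε (Module.finBasis K V i)) :=
        funext fun ε => linearMap_apply_eq_sum _ (l ∘ₗ A ε) x
      rw [e, linearMap_apply_eq_sum (Module.finBasis K V) _ x, map_sum]
      simp only [Module.Basis.constr_basis, map_smul, smul_eq_mul]
      exact HasDerivAt.fun_sum fun i _ =>
        (hasVelocity_velocity (fun l => hA (Module.finBasis K V i) l) l).const_mul _
  exact (this l).differentiableAt

omit [FiniteDimensional K V] in
theorem continuous_multilinearMap_coords {ι κ : Type*} [Fintype ι] [Fintype κ]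
    (b : Module.Basis κ K V) (f : MultilinearMap K (fun _ : ι => V) K) :
    Continuous fun x : ι → κ → K => f fun i => ∑ j, x i j • b j :=
  (continuous_multilinearMap_pi (f.compLinearMap fun _ => b.equivFun.symm.toLinearMap)).congr
    fun x => by simp [Module.Basis.equivFun_symm_apply]

omit [FiniteDimensional K W] in
theorem HasVelocity.multilinear {ι : Type*} [Fintype ι] [DecidableEq ι]
    (f : MultilinearMap K (fun _ : ι => V) W) {c : ι → ℝ → V} {c' : ι → V}
    (hc : ∀ i, HasVelocity K (c i) (c' i)) :
    HasVelocity K (fun ε => f fun i => c i ε)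
      (∑ i, f (Function.update (fun j => c j 0) i (c' i))) := by
  intro l
  set b := Module.finBasis K V
  let g := (l.compMultilinearMap f).compLinearMap fun _ : ι => b.equivFun.symm.toLinearMap
  -- In coordinates the map lives on a normed space, where the derivative of a continuous
  -- multilinear map is available; it is then restricted to real scalars.
  let G : ContinuousMultilinearMap K (fun _ : ι => Fin (Module.finrank K V) → K) K :=
    ⟨g, continuous_multilinearMap_pi g⟩
  have hG : ∀ x : ι → V, G (fun i => b.equivFun (x i)) = l (f x) := fun x => by
    change l (f fun i => b.equivFun.symm (b.equivFun (x i))) = _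
    simp
  have hx : HasDerivAt (fun ε => fun i => b.equivFun (c i ε)) (fun i => b.equivFun (c' i)) 0 :=
    hasDerivAt_pi.2 fun i => hasDerivAt_pi.2 fun j => hc i (b.coord j)
  have := (((G.hasStrictFDerivAt (fun i => b.equivFun (c i 0))).hasFDerivAt).restrictScalars
    ℝ).comp_hasDerivAt (0 : ℝ) hx
  have e : ((G.linearDeriv fun i => b.equivFun (c i 0)).restrictScalars ℝ)
      (fun i => b.equivFun (c' i)) = l (∑ i, f (Function.update (fun j => c j 0) i (c' i))) := by
    rw [map_sum]
    refine (ContinuousMultilinearMap.linearDeriv_apply _ _ _).trans ?_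
    refine Finset.sum_congr rfl fun i _ => ?_
    rw [← hG]
    congr 1
    funext j
    by_cases hj : j = i
    · subst hj; simp
    · simp [hj]
  rw [e] at this
  exact this.congr_of_eventuallyEq (Filter.Eventually.of_forall fun ε => (hG _).symm)

end Velocity

/-! ### Extension of an endomorphism to a derivation of the exterior power -/

section Derivation

variable {K V : Type*} [RCLike K] [AddCommGroup V] [Module K V] [FiniteDimensional K V]

/-- The extension of the endomorphism `s` of `V` to a derivation of `⋀^m V`. -/
noncomputable def derivation (m : ℕ) (s : V →ₗ[K] V) : ⋀[K]^m V →ₗ[K] ⋀[K]^m V :=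
  velocity (K := K) fun ε : ℝ => exteriorPower.map m (LinearMap.id + (ε : K) • s)

theorem hasVelocity_map_ιMulti (m : ℕ) (s : V →ₗ[K] V) (v : Fin m → V) :
    HasVelocity K (fun ε : ℝ => exteriorPower.map m (LinearMap.id + (ε : K) • s)
      (exteriorPower.ιMulti K m v))
      (∑ i, exteriorPower.ιMulti K m (Function.update v i (s (v i)))) := by
  have := HasVelocity.multilinear (exteriorPower.ιMulti K m (M := V)).toMultilinearMap
    (fun i => hasVelocity_affine (K := K) (v i) (s (v i)))
  simpa [exteriorPower.map_apply_ιMulti, Function.comp_def] using this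

theorem exteriorPower_induction {K V : Type*} [RCLike K] [AddCommGroup V] [Module K V] {m : ℕ}
    {motive : ⋀[K]^m V → Prop}
    (ιMulti : ∀ v, motive (exteriorPower.ιMulti K m v)) (zero : motive 0)
    (add : ∀ x y, motive x → motive y → motive (x + y))
    (smul : ∀ (c : K) x, motive x → motive (c • x)) (x : ⋀[K]^m V) : motive x := by
  have hx : x ∈ Submodule.span K (Set.range (exteriorPower.ιMulti K m (M := V))) := by
    rw [exteriorPower.ιMulti_span]; trivial
  induction hx using Submodule.span_induction with
  | mem x hx => obtain ⟨v, rfl⟩ := hx; exact ιMulti v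
  | zero => exact zero
  | add x y _ _ hx hy => exact add x y hx hy
  | smul c x _ hx => exact smul c x hx

theorem hasVelocity_map (m : ℕ) (s : V →ₗ[K] V) :
    HasVelocity K (fun ε : ℝ => exteriorPower.map m (LinearMap.id + (ε : K) • s))
      (derivation m s) := by
  -- Having some velocity is stable under linear combinations, so decomposable vectors suffice and
  -- no formula for general `x` is needed.
  have key : ∀ x : ⋀[K]^m V, ∃ y, HasVelocity K
      (fun ε : ℝ => exteriorPower.map m (LinearMap.id + (ε : K) • s) x) y := by
    intro x
    induction x using exteriorPower_induction with
    | ιMulti v => exact ⟨_, hasVelocity_map_ιMulti m s v⟩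
    | zero => exact ⟨0, fun l => by simpa using hasDerivAt_const (0 : ℝ) (0 : K)⟩
    | add x y hx hy =>
      obtain ⟨⟨a, ha⟩, b, hb⟩ := And.intro hx hy
      exact ⟨a + b, fun l => by simpa only [map_add] using (ha l).fun_add (hb l)⟩
    | smul c x hx =>
      obtain ⟨a, ha⟩ := hx
      exact ⟨c • a, fun l => by simpa using (ha l).const_mul c⟩
  refine hasVelocity_velocity_of_apply fun x l => ?_
  obtain ⟨y, hy⟩ := key x
  exact (hy l).differentiableAt

theorem derivation_ιMulti (m : ℕ) (s : V →ₗ[K] V) (v : Fin m → V) :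
    derivation m s (exteriorPower.ιMulti K m v) =
      ∑ i, exteriorPower.ιMulti K m (Function.update v i (s (v i))) := by
  refine HasVelocity.unique (K := K) ?_ (hasVelocity_map_ιMulti m s v)
  exact (hasVelocity_map m s).map (LinearMap.applyₗ (exteriorPower.ιMulti K m v))

end Derivation

/-! ### Commutators, compressions and traces of derivations -/

section Algebra

variable {K V : Type*} [RCLike K] [AddCommGroup V] [Module K V] [FiniteDimensional K V] {m : ℕ}

theorem derivation_add (s t : V →ₗ[K] V) :
    derivation m (s + t) = derivation m s + derivation m t := by
  refine exteriorPower.linearMap_ext (AlternatingMap.ext fun v => ?_)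
  simp [derivation_ιMulti, Finset.sum_add_distrib]

theorem derivation_smul (c : K) (s : V →ₗ[K] V) :
    derivation m (c • s) = c • derivation m s := by
  refine exteriorPower.linearMap_ext (AlternatingMap.ext fun v => ?_)
  simp [derivation_ιMulti, Finset.smul_sum]

variable (K V m) in
/-- `derivation` as a linear map. -/
noncomputable def derivationₗ : (V →ₗ[K] V) →ₗ[K] ⋀[K]^m V →ₗ[K] ⋀[K]^m V where
  toFun := derivation m
  map_add' := derivation_add
  map_smul' := derivation_smul

@[simp]
theorem derivationₗ_apply (s : V →ₗ[K] V) : derivationₗ K V m s = derivation m s := rfl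

theorem derivation_zero : derivation m (0 : V →ₗ[K] V) = 0 := map_zero (derivationₗ K V m)

theorem derivation_sub (s t : V →ₗ[K] V) :
    derivation m (s - t) = derivation m s - derivation m t := map_sub (derivationₗ K V m) s t

/-- The terms are separated according to whether `a` and `b` hit the same factor or two different
ones; only the former survive in the commutator. -/
theorem derivation_comp_derivation_ιMulti (a b : V →ₗ[K] V) (v : Fin m → V) :
    derivation m a (derivation m b (exteriorPower.ιMulti K m v)) =
      ∑ i, exteriorPower.ιMulti K m (Function.update v i (a (b (v i)))) +
      ∑ i, ∑ j ∈ Finset.univ.erase i, exteriorPower.ιMulti K m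
        (Function.update (Function.update v i (b (v i))) j (a (v j))) := by
  rw [derivation_ιMulti, map_sum, ← Finset.sum_add_distrib]
  refine Finset.sum_congr rfl fun i _ => ?_
  rw [derivation_ιMulti, ← Finset.add_sum_erase _ _ (Finset.mem_univ i)]
  congr 1
  · simp
  · refine Finset.sum_congr rfl fun j hj => ?_
    rw [Function.update_of_ne (Finset.ne_of_mem_erase hj)]

theorem derivation_comm (a b : V →ₗ[K] V) :
    derivation m a ∘ₗ derivation m b - derivation m b ∘ₗ derivation m a =
      derivation m (a ∘ₗ b - b ∘ₗ a) := by
  refine exteriorPower.linearMap_ext (AlternatingMap.ext fun v => ?_)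
  -- When `a` and `b` hit distinct factors the order does not matter, so these terms cancel.
  have e : ∑ i, ∑ j ∈ Finset.univ.erase i, exteriorPower.ιMulti K m
        (Function.update (Function.update v i (b (v i))) j (a (v j))) =
      ∑ i, ∑ j ∈ Finset.univ.erase i, exteriorPower.ιMulti K m
        (Function.update (Function.update v i (a (v i))) j (b (v j))) := by
    rw [Finset.sum_comm' (t' := Finset.univ) (s' := fun j => Finset.univ.erase j)
      (by intro i j; simp [eq_comm])]
    refine Finset.sum_congr rfl fun j _ => Finset.sum_congr rfl fun i hi => ?_
    rw [Function.update_comm (Finset.ne_of_mem_erase hi)]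
  simp only [LinearMap.compAlternatingMap_apply, LinearMap.sub_apply, LinearMap.comp_apply,
    derivation_sub]
  rw [derivation_comp_derivation_ιMulti, derivation_comp_derivation_ιMulti, e,
    derivation_ιMulti, derivation_ιMulti]
  simp

theorem derivation_comp_map (u π : V →ₗ[K] V) (hπ : π ∘ₗ π = π) :
    derivation m u ∘ₗ exteriorPower.map m π =
      derivation m (u ∘ₗ π) ∘ₗ exteriorPower.map m π := by
  have h2 : ∀ x, π (π x) = π x := fun x => LinearMap.congr_fun hπ x
  refine exteriorPower.linearMap_ext (AlternatingMap.ext fun v => ?_)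
  simp [derivation_ιMulti, h2]

theorem map_comp_derivation_comp_map {W : Type*} [AddCommGroup W] [Module K W]
    [FiniteDimensional K W] (f : W →ₗ[K] V) (g : V →ₗ[K] W) (hfg : g ∘ₗ f = LinearMap.id)
    (u : V →ₗ[K] V) :
    exteriorPower.map m g ∘ₗ derivation m u ∘ₗ exteriorPower.map m f =
      derivation m (g ∘ₗ u ∘ₗ f) := by
  have h2 : ∀ x, g (f x) = x := fun x => LinearMap.congr_fun hfg x
  refine exteriorPower.linearMap_ext (AlternatingMap.ext fun v => ?_)
  simp only [LinearMap.compAlternatingMap_apply, LinearMap.comp_apply,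
    exteriorPower.map_apply_ιMulti, derivation_ιMulti, map_sum]
  refine Finset.sum_congr rfl fun i _ => congrArg _ (funext fun j => ?_)
  by_cases hj : j = i
  · subst hj; simp
  · simp [hj, h2]

theorem map_comp_derivation_comp_map_self (u π : V →ₗ[K] V) (hπ : π ∘ₗ π = π) :
    exteriorPower.map m π ∘ₗ derivation m u ∘ₗ exteriorPower.map m π =
      derivation m (π ∘ₗ u ∘ₗ π) ∘ₗ exteriorPower.map m π := by
  have h2 : ∀ x, π (π x) = π x := fun x => LinearMap.congr_fun hπ x
  refine exteriorPower.linearMap_ext (AlternatingMap.ext fun v => ?_)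
  simp only [LinearMap.compAlternatingMap_apply, LinearMap.comp_apply,
    exteriorPower.map_apply_ιMulti, derivation_ιMulti, map_sum]
  refine Finset.sum_congr rfl fun i _ => congrArg _ (funext fun j => ?_)
  by_cases hj : j = i
  · subst hj; simp [h2]
  · simp [hj, h2]

/-- The source of minimality: acting twice on one factor gives `φ f = 0`, acting on two factors puts
`f` in two places of a wedge product. -/
theorem derivation_comp_derivation_smulRight (φ : V →ₗ[K] K) (f : V) (hf : φ f = 0) :
    derivation m (φ.smulRight f) ∘ₗ derivation m (φ.smulRight f) = 0 := by
  refine exteriorPower.linearMap_ext (AlternatingMap.ext fun v => ?_)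
  simp only [LinearMap.compAlternatingMap_apply, LinearMap.comp_apply,
    derivation_comp_derivation_ιMulti, LinearMap.smulRight_apply, map_smul, hf, smul_zero,
    zero_smul, AlternatingMap.map_update_zero, Finset.sum_const_zero, zero_add,
    AlternatingMap.map_update_smul, LinearMap.zero_apply]
  refine Finset.sum_eq_zero fun i _ => Finset.sum_eq_zero fun j hj => ?_
  have hij := Finset.ne_of_mem_erase hj
  rw [Function.update_comm hij.symm, AlternatingMap.map_update_smul,
    AlternatingMap.map_eq_zero_of_eq _ _ (i := i) (j := j) (by simp [hij]) hij.symm,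
    smul_zero, smul_zero]

/-- Erasing `i` is the bijection. For `m = 0` the truncated `m - 1` would give 1 in place of 0. -/
theorem card_filter_mem_powersetCard {n : ℕ} (hm : 1 ≤ m) (i : Fin n) :
    (Finset.univ.filter fun s : Set.powersetCard (Fin n) m =>
      i ∈ (s : Finset (Fin n))).card = (n - 1).choose (m - 1) := by
  classical
  have h1 : (Finset.powersetCard (m - 1) (Finset.univ.erase i)).card = (n - 1).choose (m - 1) := by
    simp
  rw [← h1]
  refine Finset.card_bij (fun s _ => (s : Finset (Fin n)).erase i) ?_ ?_ ?_
  · intro s hs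
    rw [Finset.mem_powersetCard, Finset.card_erase_of_mem (by simpa using hs),
      Set.powersetCard.card_eq]
    exact ⟨Finset.erase_subset_erase _ (Finset.subset_univ _), rfl⟩
  · intro s hs t ht hst
    apply Subtype.ext
    rw [← Finset.insert_erase (Finset.mem_filter.1 hs).2, hst,
      Finset.insert_erase (Finset.mem_filter.1 ht).2]
  · intro s hs
    rw [Finset.mem_powersetCard] at hs
    have hi : i ∉ s := fun h => by simpa using hs.1 h
    refine ⟨⟨insert i s, ?_⟩, by simp, Finset.erase_insert hi⟩
    change (insert i s).card = m
    rw [Finset.card_insert_of_notMem hi, hs.2]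
    omega

/-- The diagonal entry of `D(u)` at the basis vector `e_s` is `∑_{i ∈ s} u_ii`, and each index lies
in `(n-1 choose m-1)` of the sets `s`. -/
theorem trace_derivation (hm : 1 ≤ m) (u : V →ₗ[K] V) :
    LinearMap.trace K _ (derivation m u) =
      ((Module.finrank K V - 1).choose (m - 1) : K) * LinearMap.trace K V u := by
  classical
  set n := Module.finrank K V
  set b := Module.finBasis K V
  have diag : ∀ s : Set.powersetCard (Fin n) m,
      (b.exteriorPower m).repr (derivation m u (b.exteriorPower m s)) s =
        ∑ i ∈ (s : Finset (Fin n)), b.repr (u (b i)) i := by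
    intro s
    rw [exteriorPower.basis_repr_apply, exteriorPower.basis_apply, exteriorPower.ιMulti_family,
      derivation_ιMulti, map_sum]
    set e := Set.powersetCard.ofFinEmbEquiv.symm s with he
    have hs : (s : Finset (Fin n)) = Finset.univ.map e.toEmbedding := by
      ext i
      rw [Finset.mem_map]
      have := Set.powersetCard.mem_range_ofFinEmbEquiv_symm_iff_mem s i
      simp only [Finset.mem_univ, true_and]
      exact this.symm
    rw [hs, Finset.sum_map]
    refine Finset.sum_congr rfl fun i _ => ?_
    have h1 : ∀ x : V, exteriorPower.ιMultiDual K m b s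
        (exteriorPower.ιMulti K m (Function.update (b ∘ e) i x)) = b.repr x (e i) := by
      intro x
      rw [exteriorPower.ιMultiDual_apply_ιMulti, ← he]
      -- The coordinate is the determinant of an identity matrix with one row replaced; Cramer's
      -- rule for the identity reads off the entry.
      have : (Matrix.of fun k j => b.coord (e j) (Function.update (b ∘ e) i x k)) =
          (1 : Matrix (Fin m) (Fin m) K).updateRow i (fun j => b.repr x (e j)) := by
        ext k j
        by_cases hk : k = i
        · subst hk; simp
        · simp [hk, Matrix.one_apply, Finsupp.single_apply]
      rw [this, ← Matrix.cramer_transpose_apply]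
      simp
    exact h1 _
  rw [LinearMap.trace_eq_matrix_trace K (b.exteriorPower m), LinearMap.trace_eq_matrix_trace K b,
    Matrix.trace, Matrix.trace]
  simp only [Matrix.diag_apply, LinearMap.toMatrix_apply, diag]
  rw [Finset.sum_comm' (t' := Finset.univ) (s' := fun i => Finset.univ.filter
    fun s : Set.powersetCard (Fin n) m => i ∈ (s : Finset (Fin n))) (by simp)]
  simp only [Finset.sum_const, card_filter_mem_powersetCard hm, nsmul_eq_mul, Finset.mul_sum]
  rfl

end Algebra

/-! ### Orthogonal projectors, adjoints and Gram matrices for a hermitian form -/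

section Hermitian

variable {K V : Type*} [RCLike K] [AddCommGroup V] [Module K V]
  {h : V →ₗ⋆[K] V →ₗ[K] K} {p : Submodule K V} {k : ℕ}

theorem isCompl_and_proj_eq (hh : IsHermitianForm h)
    (hp : ∀ x ∈ p, (∀ y ∈ p, h x y = 0) → x = 0) (π : V →ₗ[K] V)
    (h1 : ∀ x, π x ∈ p) (h2 : ∀ x, x - π x ∈ perp h p) :
    IsCompl p (perp h p) ∧ proj h p = π := by
  have hc : IsCompl p (perp h p) := by
    refine ⟨Submodule.disjoint_def.2 fun x hx hx' => hp x hx fun y hy => ?_,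
      codisjoint_iff.2 (eq_top_iff.2 fun x _ => ?_)⟩
    · rw [← hh.conj_symm, hx' y hy, map_zero]
    · rw [← add_sub_cancel (π x) x]
      exact Submodule.add_mem_sup (h1 x) (h2 x)
  refine ⟨hc, LinearMap.ext fun x => ?_⟩
  rw [proj, dif_pos hc]
  conv_lhs => rw [← add_sub_cancel (π x) x, map_add,
    Submodule.projection_apply_of_mem_left hc (h1 x),
    (Submodule.projection_apply_eq_zero_iff hc).2 (h2 x), add_zero]

/-- The Gram matrix of a family of vectors. -/
def gram (h : V →ₗ⋆[K] V →ₗ[K] K) (a : Fin k → V) : Matrix (Fin k) (Fin k) K :=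
  Matrix.of fun i j => h (a i) (a j)

theorem gram_mulVec (a : Fin k → V) (c : Fin k → K) (i : Fin k) :
    (gram h a).mulVec c i = h (a i) (∑ j, c j • a j) := by
  simp [gram, Matrix.mulVec, dotProduct, mul_comm]

theorem isHermitian_gram (hh : IsHermitianForm h) (a : Fin k → V) : (gram h a).IsHermitian := by
  ext i j
  simpa [gram] using hh.conj_symm (a j) (a i)

/-- A kernel vector `c` of the Gram matrix is the same as a combination `∑ c_j a_j` orthogonal to
the whole span. Thus `Gr0` becomes a determinant condition on frames. -/
theorem mem_gr0_iff_of_basis_span (hh : IsHermitianForm h) (a : Fin k → V) :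
    (LinearIndependent K a ∧ Submodule.span K (Set.range a) ∈ Gr0 h k) ↔
      (gram h a).det ≠ 0 := by
  have key : ∀ x : V, (∀ i, h (a i) x = 0) →
      ∀ y ∈ Submodule.span K (Set.range a), h x y = 0 := fun x hx y hy => by
    induction hy using Submodule.span_induction with
    | mem y hy => obtain ⟨i, rfl⟩ := hy; rw [← hh.conj_symm, hx, map_zero]
    | zero => simp
    | add y z _ _ h1 h2 => rw [map_add, h1, h2, add_zero]
    | smul c y _ h1 => rw [map_smul, h1, smul_zero]
  constructor
  · rintro ⟨hli, -, hnd⟩ hdet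
    obtain ⟨c, hc, hc0⟩ := Matrix.exists_mulVec_eq_zero_iff.2 hdet
    have hx : ∑ j, c j • a j = 0 := hnd _ (Submodule.sum_mem _ fun j _ =>
      Submodule.smul_mem _ _ (Submodule.subset_span ⟨j, rfl⟩)) (key _ fun i => by
        rw [← gram_mulVec, hc0]; rfl)
    exact hc (funext (Fintype.linearIndependent_iff.1 hli c hx))
  · intro hdet
    have inj : ∀ c : Fin k → K, (∀ i, h (a i) (∑ j, c j • a j) = 0) → c = 0 := fun c hc => by
      by_contra hne
      exact hdet (Matrix.exists_mulVec_eq_zero_iff.1 ⟨c, hne, funext fun i => by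
        rw [gram_mulVec, hc]; rfl⟩)
    have hli : LinearIndependent K a := Fintype.linearIndependent_iff.2 fun c hc =>
      congrFun (inj c fun i => by rw [hc, map_zero])
    refine ⟨hli, by rw [finrank_span_eq_card hli, Fintype.card_fin], fun x hx hx0 => ?_⟩
    obtain ⟨c, rfl⟩ := (Submodule.mem_span_range_iff_exists_fun K).1 hx
    have : c = 0 := inj c fun i => by
      rw [← hh.conj_symm, hx0 _ (Submodule.subset_span ⟨i, rfl⟩), map_zero]
    simp [this]

/-- The orthogonal projector onto the span of `a` in terms of the inverse of the Gram matrix. -/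
noncomputable def gramProj (h : V →ₗ⋆[K] V →ₗ[K] K) (a : Fin k → V) : V →ₗ[K] V :=
  ∑ i, ∑ j, (gram h a)⁻¹ i j • (h (a j)).smulRight (a i)

theorem gramProj_apply (a : Fin k → V) (x : V) :
    gramProj h a x = ∑ i, (∑ j, (gram h a)⁻¹ i j * h (a j) x) • a i := by
  simp [gramProj, LinearMap.sum_apply, Finset.sum_smul, smul_smul]

theorem isCompl_and_proj_span_eq (hh : IsHermitianForm h) (a : Fin k → V)
    (ha : (gram h a).det ≠ 0) :
    IsCompl (Submodule.span K (Set.range a)) (perp h (Submodule.span K (Set.range a))) ∧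
      proj h (Submodule.span K (Set.range a)) = gramProj h a := by
  refine isCompl_and_proj_eq hh ((mem_gr0_iff_of_basis_span hh a).2 ha).2.2 _ (fun x => ?_)
    fun x y hy => ?_
  · rw [gramProj_apply]
    exact Submodule.sum_mem _ fun j _ => Submodule.smul_mem _ _ (Submodule.subset_span ⟨j, rfl⟩)
  · induction hy using Submodule.span_induction with
    | mem y hy =>
      obtain ⟨i, rfl⟩ := hy
      rw [gramProj_apply, map_sub, ← gram_mulVec]
      have : (fun i => ∑ j, (gram h a)⁻¹ i j * h (a j) x) =
        (gram h a)⁻¹.mulVec fun j => h (a j) x := rfl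
      rw [this, Matrix.mulVec_mulVec, Matrix.mul_nonsing_inv _ (isUnit_iff_ne_zero.2 ha),
        Matrix.one_mulVec, sub_self]
    | zero => simp
    | add y z _ _ h1 h2 => rw [map_add, LinearMap.add_apply, h1, h2, add_zero]
    | smul c y _ h1 => rw [LinearMap.map_smulₛₗ, LinearMap.smul_apply, h1, smul_zero]

variable [FiniteDimensional K V]

theorem exists_frame_of_mem_gr0 (hh : IsHermitianForm h) (hp : p ∈ Gr0 h k) :
    ∃ a : Fin k → V, LinearIndependent K a ∧ Submodule.span K (Set.range a) = p ∧
      (gram h a).det ≠ 0 := by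
  have b := Module.finBasisOfFinrankEq K p hp.1
  have h1 : LinearIndependent K (fun i => (b i : V)) :=
    b.linearIndependent.map' p.subtype p.ker_subtype
  have h2 : Submodule.span K (Set.range fun i => (b i : V)) = p := by
    have : (Set.range fun i => (b i : V)) = p.subtype '' Set.range b := by
      rw [← Set.range_comp]; rfl
    rw [this, Submodule.span_image, b.span_eq, Submodule.map_top, Submodule.range_subtype]
  exact ⟨_, h1, h2, (mem_gr0_iff_of_basis_span hh _).1 ⟨h1, h2.symm ▸ hp⟩⟩

theorem isCompl_perp (hh : IsHermitianForm h) (hp : p ∈ Gr0 h k) : IsCompl p (perp h p) := by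
  obtain ⟨a, -, rfl, ha⟩ := exists_frame_of_mem_gr0 hh hp
  exact (isCompl_and_proj_span_eq hh a ha).1

theorem proj_eq_projection (hh : IsHermitianForm h) (hp : p ∈ Gr0 h k) :
    proj h p = p.projection (perp h p) (isCompl_perp hh hp) := dif_pos _

theorem proj_mem (hh : IsHermitianForm h) (hp : p ∈ Gr0 h k) (x : V) : proj h p x ∈ p := by
  rw [proj_eq_projection hh hp]
  exact Submodule.projection_apply_mem _ _

theorem proj_of_mem (hh : IsHermitianForm h) (hp : p ∈ Gr0 h k) {x : V} (hx : x ∈ p) :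
    proj h p x = x := by
  rw [proj_eq_projection hh hp]
  exact Submodule.projection_apply_of_mem_left _ hx

theorem proj_eq_zero_iff (hh : IsHermitianForm h) (hp : p ∈ Gr0 h k) {x : V} :
    proj h p x = 0 ↔ x ∈ perp h p := by
  rw [proj_eq_projection hh hp]
  exact Submodule.projection_apply_eq_zero_iff _

theorem proj_proj (hh : IsHermitianForm h) (hp : p ∈ Gr0 h k) (x : V) :
    proj h p (proj h p x) = proj h p x := proj_of_mem hh hp (proj_mem hh hp x)

theorem proj_comp_proj (hh : IsHermitianForm h) (hp : p ∈ Gr0 h k) :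
    proj h p ∘ₗ proj h p = proj h p := LinearMap.ext (proj_proj hh hp)

theorem sub_proj_mem_perp (hh : IsHermitianForm h) (hp : p ∈ Gr0 h k) (x : V) :
    x - proj h p x ∈ perp h p := by
  rw [← proj_eq_zero_iff hh hp, map_sub, proj_proj hh hp, sub_self]

theorem form_proj_left (hh : IsHermitianForm h) (hp : p ∈ Gr0 h k) (x y : V) :
    h (proj h p x) y = h x (proj h p y) := by
  have h1 : h (proj h p x) (y - proj h p y) = 0 := sub_proj_mem_perp hh hp y _ (proj_mem hh hp x)
  have h2 : h (proj h p y) (x - proj h p x) = 0 := sub_proj_mem_perp hh hp x _ (proj_mem hh hp y)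
  rw [map_sub, sub_eq_zero] at h1 h2
  rw [h1, ← hh.conj_symm, ← h2, hh.conj_symm]

theorem proj_injOn (hh : IsHermitianForm h) {q : Submodule K V} {l : ℕ} (hp : p ∈ Gr0 h k)
    (hq : q ∈ Gr0 h l) (hpq : proj h p = proj h q) : p = q := by
  ext x
  exact ⟨fun hx => by rw [← proj_of_mem hh hp hx, hpq]; exact proj_mem hh hq x,
    fun hx => by rw [← proj_of_mem hh hq hx, ← hpq]; exact proj_mem hh hp x⟩

theorem mem_tangent_iff (hh : IsHermitianForm h) (hp : p ∈ Gr0 h k) {t : V →ₗ[K] V} :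
    t ∈ tangent h p ↔ t ∘ₗ proj h p = t ∧ proj h p ∘ₗ t = 0 := by
  constructor
  · rintro ⟨h1, h2⟩
    refine ⟨LinearMap.ext fun x => ?_, LinearMap.ext fun x => (proj_eq_zero_iff hh hp).2 (h2 x)⟩
    have := h1 _ (sub_proj_mem_perp hh hp x)
    rw [map_sub, sub_eq_zero] at this
    exact this.symm
  · rintro ⟨h1, h2⟩
    refine ⟨fun x hx => ?_, fun x => (proj_eq_zero_iff hh hp).1 (LinearMap.congr_fun h2 x)⟩
    rw [← h1, LinearMap.comp_apply, (proj_eq_zero_iff hh hp).2 hx, map_zero]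

omit [FiniteDimensional K V] in
theorem compress_apply (t : V →ₗ[K] V) (x : V) :
    compress h p t x = t (proj h p x) - proj h p (t (proj h p x)) := rfl

theorem compress_mem_tangent (hh : IsHermitianForm h) (hp : p ∈ Gr0 h k) (t : V →ₗ[K] V) :
    compress h p t ∈ tangent h p := by
  refine (mem_tangent_iff hh hp).2 ⟨LinearMap.ext fun x => ?_, LinearMap.ext fun x => ?_⟩
  · simp only [LinearMap.comp_apply, compress_apply, proj_proj hh hp]
  · simp only [LinearMap.comp_apply, compress_apply, map_sub, proj_proj hh hp, sub_self,
      LinearMap.zero_apply]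

theorem compress_of_mem_tangent (hh : IsHermitianForm h) (hp : p ∈ Gr0 h k) {t : V →ₗ[K] V}
    (ht : t ∈ tangent h p) : compress h p t = t := by
  obtain ⟨h1, h2⟩ := (mem_tangent_iff hh hp).1 ht
  ext x
  have h1' := LinearMap.congr_fun h1 x
  have h2' := LinearMap.congr_fun h2 x
  rw [LinearMap.comp_apply] at h1' h2'
  rw [compress_apply, h1', h2', LinearMap.zero_apply, sub_zero]

/-- Over `ℝ` or `ℂ`, a nondegenerate hermitian form can be diagonalized. -/
theorem exists_resolution (hh : IsHermitianForm h) :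
    ∃ (n : ℕ) (c : Fin n → ℝ) (g : Fin n → V), ∀ x, x = ∑ r, ((c r : K) * h (g r) x) • g r := by
  set b := Module.finBasis K V
  have hb : (gram h b).det ≠ 0 := by
    refine (mem_gr0_iff_of_basis_span hh b).1 ⟨b.linearIndependent, ?_⟩
    rw [b.span_eq]
    exact ⟨finrank_top K V, fun x _ hx => hh.nondegenerate x fun y => hx y trivial⟩
  -- The projector onto the whole space is the identity, which resolves it through the inverse Gram
  -- matrix of a basis.
  have hid : ∀ x, gramProj h b x = x := fun x => by
    have h1 := (isCompl_and_proj_span_eq hh b hb).2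
    have h2 := ((mem_gr0_iff_of_basis_span hh b).2 hb).2
    rw [← h1]
    exact proj_of_mem hh h2 (b.span_eq ▸ trivial)
  have hG : ((gram h b)⁻¹).IsHermitian := (isHermitian_gram hh b).inv
  set U : Matrix (Fin (Module.finrank K V)) (Fin (Module.finrank K V)) K :=
    hG.eigenvectorUnitary.1
  have hU : ∀ i j, (gram h b)⁻¹ i j = ∑ r, U i r * (hG.eigenvalues r : K) * conj (U j r) := by
    intro i j
    have := congrFun (congrFun hG.spectral_theorem i) j
    rw [Unitary.conjStarAlgAut_apply] at this
    rw [this, Matrix.mul_apply]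
    simp only [Matrix.mul_diagonal, Matrix.star_apply, Function.comp_apply, RCLike.star_def]
    rfl
  -- Unitary diagonalization of the inverse Gram matrix: `c` consists of its real eigenvalues, and
  -- the eigenvectors are the coordinates of the `g r`.
  refine ⟨_, hG.eigenvalues, fun r => ∑ i, U i r • b i, fun x => ?_⟩
  conv_lhs => rw [← hid x, gramProj_apply]
  simp only [hU, map_sum, LinearMap.map_smulₛₗ, LinearMap.sum_apply, LinearMap.smul_apply,
    Finset.smul_sum, Finset.sum_mul, Finset.mul_sum, smul_smul, Finset.sum_smul, smul_eq_mul]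
  refine (Finset.sum_congr rfl fun i _ => Finset.sum_comm).trans (Finset.sum_comm.trans
    (Finset.sum_congr rfl fun r _ => Finset.sum_congr rfl fun i _ =>
      Finset.sum_congr rfl fun j _ => ?_))
  congr 1
  ring

theorem exists_adj (hh : IsHermitianForm h) (t : V →ₗ[K] V) :
    ∃ s : V →ₗ[K] V, ∀ x y, h (t x) y = h x (s y) := by
  obtain ⟨n, c, g, hg⟩ := exists_resolution hh
  refine ⟨∑ r, (c r : K) • (h (t (g r))).smulRight (g r), fun x y => ?_⟩
  conv_lhs => rw [hg x]
  simp only [map_sum, LinearMap.map_smulₛₗ, map_smul, LinearMap.sum_apply, LinearMap.smul_apply,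
    LinearMap.smulRight_apply, map_mul, RCLike.conj_ofReal, hh.conj_symm, smul_eq_mul]
  exact Finset.sum_congr rfl fun r _ => by ring

theorem form_adj (hh : IsHermitianForm h) (t : V →ₗ[K] V) (x y : V) :
    h (t x) y = h x (adj h t y) := by
  have ht := exists_adj hh t
  rw [adj, dif_pos ht]
  exact ht.choose_spec x y

omit [FiniteDimensional K V] in
theorem IsHermitianForm.ext (hh : IsHermitianForm h) {y z : V} (hyz : ∀ x, h x y = h x z) :
    y = z := by
  refine sub_eq_zero.1 (hh.nondegenerate _ fun x => ?_)
  rw [← hh.conj_symm, map_sub, hyz, sub_self, map_zero]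

theorem adj_eq (hh : IsHermitianForm h) {s t : V →ₗ[K] V} (hst : ∀ x y, h (t x) y = h x (s y)) :
    adj h t = s :=
  LinearMap.ext fun y => hh.ext fun x => by rw [← form_adj hh, hst]

/-- These are the adjoints of `t π = t` and `π t = 0`, the projector being self-adjoint. -/
theorem adj_mem (hh : IsHermitianForm h) (hp : p ∈ Gr0 h k) {t : V →ₗ[K] V}
    (ht : t ∈ tangent h p) : proj h p ∘ₗ adj h t = adj h t ∧ adj h t ∘ₗ proj h p = 0 := by
  obtain ⟨h1, h2⟩ := (mem_tangent_iff hh hp).1 ht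
  refine ⟨LinearMap.ext fun y => hh.ext fun x => ?_, LinearMap.ext fun y => hh.ext fun x => ?_⟩
  · rw [LinearMap.comp_apply, ← form_proj_left hh hp, ← form_adj hh, ← LinearMap.comp_apply t,
      h1, form_adj hh]
  · rw [LinearMap.comp_apply, ← form_adj hh, ← form_proj_left hh hp, ← LinearMap.comp_apply _ t,
      h2]
    simp

theorem hermitianMetric_conj_symm (hh : IsHermitianForm h) (s t : V →ₗ[K] V) :
    conj (hermitianMetric h s t) = hermitianMetric h t s := by
  obtain ⟨n, c, g, hg⟩ := exists_resolution hh
  -- Inserting the diagonal resolution expresses the trace through the form with real weights, so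
  -- conjugation can be moved across it.
  have tr : ∀ u : V →ₗ[K] V, LinearMap.trace K V u = ∑ r, (c r : K) * h (g r) (u (g r)) := by
    intro u
    have : u = ∑ r, (c r : K) • (h (g r)).smulRight (u (g r)) := LinearMap.ext fun x => by
      conv_lhs => rw [hg x]
      simp [LinearMap.sum_apply, smul_smul]
    conv_lhs => rw [this]
    simp [map_sum, LinearMap.trace_smulRight]
  rw [hermitianMetric, hermitianMetric, tr, tr, map_sum]
  refine Finset.sum_congr rfl fun r _ => ?_
  simp only [LinearMap.comp_apply, map_mul, RCLike.conj_ofReal, ← form_adj hh, hh.conj_symm]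

theorem metric_comm (hh : IsHermitianForm h) (s t : V →ₗ[K] V) : metric h s t = metric h t s := by
  rw [metric, ← hermitianMetric_conj_symm hh, RCLike.conj_re]; rfl

end Hermitian

/-! ### Rank-one tangent vectors and nondegeneracy of the metric -/

section Frames

variable {K V : Type*} [RCLike K] [AddCommGroup V] [Module K V] [FiniteDimensional K V]
  {h : V →ₗ⋆[K] V →ₗ[K] K} {p : Submodule K V} {k : ℕ}

/-- The tangent space at `p` has a finite family of vectors of rank one whose squares, suitably
scaled, add up to the inverse of the metric. -/
theorem exists_rank_one_family (hh : IsHermitianForm h) (hp : p ∈ Gr0 h k) :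
    ∃ (ι : Type) (_ : Fintype ι) (c : ι → ℝ) (φ : ι → V →ₗ[K] K) (f : ι → V),
      (∀ j, (φ j).smulRight (f j) ∈ tangent h p) ∧ (∀ j, φ j (f j) = 0) ∧
      ∀ x ∈ tangent h p, x = ∑ j, ((c j * metric h ((φ j).smulRight (f j)) x : ℝ) : K) •
        (φ j).smulRight (f j) := by
  obtain ⟨n, c, g, hg⟩ := exists_resolution hh
  set π := proj h p with hπ
  have hpe : ∀ x r, h (π (g r)) x = h (g r) (π x) := fun x r => form_proj_left hh hp _ _
  have hpp : ∀ x, π (π x) = π x := proj_proj hh hp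
  -- The rank-one maps `g_s^* ⊗ g_r`, compressed to the tangent space at `p`.
  let τ : Fin n × Fin n → V →ₗ[K] V := fun rs =>
    (h (π (g rs.2))).smulRight (g rs.1 - π (g rs.1))
  have hτ : ∀ rs, τ rs ∈ tangent h p := fun rs => by
    refine (mem_tangent_iff hh hp).2 ⟨LinearMap.ext fun x => ?_, LinearMap.ext fun x => ?_⟩
    · simp [τ, ← hπ, hpe, hpp]
    · simp [τ, ← hπ, hpp]
  have hmet : ∀ (rs : Fin n × Fin n) (z : K), ∀ x ∈ tangent h p,
      hermitianMetric h (z • τ rs) x = conj z * h (g rs.1) (x (g rs.2)) := by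
    intro rs z x hx
    obtain ⟨h1, h2⟩ := (mem_tangent_iff hh hp).1 hx
    have h1' : ∀ y, x (π y) = x y := LinearMap.congr_fun h1
    have h2' : ∀ y, π (x y) = 0 := LinearMap.congr_fun h2
    have ha : adj h (z • τ rs) =
        conj z • (h (g rs.1 - π (g rs.1))).smulRight (π (g rs.2)) := by
      refine adj_eq hh fun y w => ?_
      simp only [τ, LinearMap.smul_apply, LinearMap.smulRight_apply, LinearMap.map_smulₛₗ,
        map_smul, smul_eq_mul, hh.conj_symm]
      ring
    have e : adj h (z • τ rs) ∘ₗ x =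
        conj z • (h (g rs.1 - π (g rs.1)) ∘ₗ x).smulRight (π (g rs.2)) := by
      rw [ha]; rfl
    rw [hermitianMetric, e, map_smul, LinearMap.trace_smulRight, LinearMap.comp_apply, h1',
      map_sub, LinearMap.sub_apply, hpe, h2', map_zero, sub_zero, smul_eq_mul]
  have hexp : ∀ x ∈ tangent h p,
      x = ∑ rs : Fin n × Fin n, ((c rs.1 * c rs.2 : ℝ) * h (g rs.1) (x (g rs.2)) : K) • τ rs := by
    intro x hx
    obtain ⟨h1, h2⟩ := (mem_tangent_iff hh hp).1 hx
    have h1' : ∀ y, x (π y) = x y := LinearMap.congr_fun h1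
    have h2' : ∀ y, π (x y) = 0 := LinearMap.congr_fun h2
    ext y
    have e1 : x y = x (∑ r, ((c r : K) * h (g r) (π y)) • g r) := by rw [← hg, h1']
    have e2 : ∀ z, x z = ∑ r, ((c r : K) * h (g r) (x z)) • (g r - π (g r)) := fun z => by
      have e3 := congrArg (LinearMap.id - π : V →ₗ[K] V) (hg (x z))
      simpa only [map_sum, map_smul, LinearMap.sub_apply, LinearMap.id_apply, h2', sub_zero]
        using e3
    rw [e1, map_sum, LinearMap.sum_apply, Fintype.sum_prod_type_right]
    refine Finset.sum_congr rfl fun s _ => ?_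
    rw [map_smul]
    conv_lhs => rw [e2 (g s), Finset.smul_sum]
    refine Finset.sum_congr rfl fun r _ => ?_
    simp only [τ, LinearMap.smul_apply, LinearMap.smulRight_apply, smul_smul, hpe]
    congr 1
    push_cast
    ring
  -- Pairing `x` with `τ` in the real metric gives the real part of its coefficient, pairing with `I
  -- • τ` the imaginary part; hence two copies of the family. Over `ℝ` the second copy is zero.
  refine ⟨(Fin n × Fin n) ⊕ (Fin n × Fin n), inferInstance,
    Sum.elim (fun rs => c rs.1 * c rs.2) (fun rs => c rs.1 * c rs.2),
    Sum.elim (fun rs => h (π (g rs.2))) (fun rs => (RCLike.I : K) • h (π (g rs.2))),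
    Sum.elim (fun rs => g rs.1 - π (g rs.1)) (fun rs => g rs.1 - π (g rs.1)), ?_, ?_, ?_⟩
  · have : ∀ rs, ((RCLike.I : K) • h (π (g rs.2))).smulRight (g rs.1 - π (g rs.1)) =
        (RCLike.I : K) • τ rs := fun rs => by ext; simp [τ, smul_smul]
    rintro (rs | rs)
    · exact hτ rs
    · simp only [Sum.elim_inr, this]
      exact Submodule.smul_mem _ _ (hτ rs)
  · have : ∀ rs : Fin n × Fin n, h (π (g rs.2)) (g rs.1 - π (g rs.1)) = 0 := fun rs => by
      rw [hpe, map_sub, proj_proj hh hp, sub_self, map_zero]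
    rintro (rs | rs)
    · exact this rs
    · simp [this]
  · intro x hx
    have : ∀ rs, ((RCLike.I : K) • h (π (g rs.2))).smulRight (g rs.1 - π (g rs.1)) =
        (RCLike.I : K) • τ rs := fun rs => by ext; simp [τ, smul_smul]
    simp only [Fintype.sum_sum_type, Sum.elim_inl, Sum.elim_inr, this]
    rw [← Finset.sum_add_distrib]
    conv_lhs => rw [hexp x hx]
    refine Finset.sum_congr rfl fun rs _ => ?_
    change _ = ((_ * metric h (τ rs) x : ℝ) : K) • τ rs + _
    rw [smul_smul, ← add_smul]
    congr 1
    have m1 : metric h (τ rs) x = RCLike.re (h (g rs.1) (x (g rs.2))) := by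
      have := hmet rs 1 x hx
      rw [one_smul, map_one, one_mul] at this
      rw [metric, this]
    have m2 : metric h ((RCLike.I : K) • τ rs) x = RCLike.im (h (g rs.1) (x (g rs.2))) := by
      rw [metric, hmet _ _ x hx]
      simp
    rw [m1, m2]
    conv_lhs => rw [← RCLike.re_add_im (h (g rs.1) (x (g rs.2)))]
    push_cast
    ring

theorem tangent_eq_zero_of_metric (hh : IsHermitianForm h) (hp : p ∈ Gr0 h k) {s : V →ₗ[K] V}
    (hs : s ∈ tangent h p) (h0 : ∀ t ∈ tangent h p, metric h s t = 0) : s = 0 := by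
  obtain ⟨ι, _, c, φ, f, h1, -, h3⟩ := exists_rank_one_family hh hp
  rw [h3 s hs]
  refine Finset.sum_eq_zero fun j _ => ?_
  rw [metric_comm hh, h0 _ (h1 j)]
  simp

end Frames

/-! ### Degree counting with a number operator -/

section Grading

variable {K W : Type*} [RCLike K] [AddCommGroup W] [Module K W] {N R S T C P : W →ₗ[K] W}

/-- Here and below `N` counts degree, `S` and `T` raise it, `R` lowers it, and `P` plays the
projector onto degree 0. -/
theorem comp_comp_of_commutator (h : R ∘ₗ T - T ∘ₗ R = C) (h0 : R ∘ₗ P = 0) :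
    R ∘ₗ T ∘ₗ P = C ∘ₗ P := by
  subst h
  ext x
  have := LinearMap.congr_fun h0 x
  rw [LinearMap.comp_apply, LinearMap.zero_apply] at this
  simp [this]

theorem comp_raise_raise (hS : N ∘ₗ S - S ∘ₗ N = S) (hT : N ∘ₗ T - T ∘ₗ N = T)
    (hP : N ∘ₗ P = 0) (x : W) : N (S (T (P x))) = (2 : K) • S (T (P x)) := by
  have hS' : ∀ x, N (S x) = S (N x) + S x := fun x => by
    rw [← sub_eq_iff_eq_add']; exact LinearMap.congr_fun hS x
  have hT' : ∀ x, N (T x) = T (N x) + T x := fun x => by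
    rw [← sub_eq_iff_eq_add']; exact LinearMap.congr_fun hT x
  have hP' : N (P x) = 0 := LinearMap.congr_fun hP x
  rw [hS', hT', hP', map_zero, zero_add, two_smul]

theorem comp_raise_raise_eq_zero (hS : N ∘ₗ S - S ∘ₗ N = S) (hT : N ∘ₗ T - T ∘ₗ N = T)
    (hP : N ∘ₗ P = 0) (hP' : P ∘ₗ N = 0) : P ∘ₗ S ∘ₗ T ∘ₗ P = 0 := by
  ext x
  have h1 : P (N (S (T (P x)))) = 0 := LinearMap.congr_fun hP' _
  rw [comp_raise_raise hS hT hP, map_smul] at h1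
  exact (smul_eq_zero.1 h1).resolve_left two_ne_zero

/-- `R S T P` has degree `2 - 1 = 1`, so `N` fixes its values, while `P N = 0`. -/
theorem comp_lower_raise_raise_eq_zero (hR : N ∘ₗ R - R ∘ₗ N = -R) (hS : N ∘ₗ S - S ∘ₗ N = S)
    (hT : N ∘ₗ T - T ∘ₗ N = T) (hP : N ∘ₗ P = 0) (hP' : P ∘ₗ N = 0) :
    P ∘ₗ R ∘ₗ S ∘ₗ T ∘ₗ P = 0 := by
  ext x
  have hR' : ∀ x, N (R x) = R (N x) - R x := fun x => by
    rw [sub_eq_add_neg, ← sub_eq_iff_eq_add']; exact LinearMap.congr_fun hR x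
  have h1 : P (N (R (S (T (P x))))) = 0 := LinearMap.congr_fun hP' _
  rwa [hR', comp_raise_raise hS hT hP, map_smul, two_smul, add_sub_cancel_right] at h1

end Grading

/-! ### The form on the exterior power, the Plücker differential and its normal complement -/

section WedgeForm

variable {K V : Type*} [RCLike K] [AddCommGroup V] [Module K V]
  {h : V →ₗ⋆[K] V →ₗ[K] K} {p : Submodule K V} {k m : ℕ}

theorem wedgeForm_eq_of_ιMulti {W : Type*} [AddCommGroup W] [Module K W]
    {b c : ⋀[K]^m V →ₗ⋆[K] ⋀[K]^m W →ₗ[K] K}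
    (hbc : ∀ v w, b (exteriorPower.ιMulti K m v) (exteriorPower.ιMulti K m w) =
      c (exteriorPower.ιMulti K m v) (exteriorPower.ιMulti K m w)) (x : ⋀[K]^m V)
    (y : ⋀[K]^m W) : b x y = c x y := by
  induction x using exteriorPower_induction with
  | ιMulti v =>
    induction y using exteriorPower_induction with
    | ιMulti w => exact hbc v w
    | zero => simp
    | add y z hy hz => rw [map_add, map_add, hy, hz]
    | smul a y hy => rw [map_smul, map_smul, hy]
  | zero => simp
  | add x z hx hz => rw [map_add, map_add, LinearMap.add_apply, LinearMap.add_apply, hx, hz]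
  | smul a x hx => rw [LinearMap.map_smulₛₗ, LinearMap.map_smulₛₗ, LinearMap.smul_apply,
      LinearMap.smul_apply, hx]

theorem wedgeForm_conj_symm (hh : IsHermitianForm h) (x y : ⋀[K]^m V) :
    conj (wedgeForm h m x y) = wedgeForm h m y x := by
  induction x using exteriorPower_induction with
  | ιMulti v =>
    induction y using exteriorPower_induction with
    | ιMulti w =>
      rw [wedgeForm_ιMulti, wedgeForm_ιMulti, RingHom.map_det, ← Matrix.det_transpose]
      congr 1
      ext i j
      exact hh.conj_symm _ _
    | zero => simp
    | add y z hy hz => simp only [map_add, LinearMap.add_apply, hy, hz]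
    | smul a y hy => simp only [map_smul, LinearMap.map_smulₛₗ, LinearMap.smul_apply, smul_eq_mul,
        map_mul, hy]
  | zero => simp
  | add x z hx hz => simp only [map_add, LinearMap.add_apply, hx, hz]
  | smul a x hx => simp only [map_smul, LinearMap.map_smulₛₗ, LinearMap.smul_apply, smul_eq_mul,
        map_mul, hx, RCLike.conj_conj]

theorem wedgeForm_map_left {a b : V →ₗ[K] V} (hab : ∀ x y, h (a x) y = h x (b y))
    (x y : ⋀[K]^m V) :
    wedgeForm h m (exteriorPower.map m a x) y = wedgeForm h m x (exteriorPower.map m b y) := by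
  refine wedgeForm_eq_of_ιMulti (b := (wedgeForm h m).comp (exteriorPower.map m a))
    (c := (wedgeForm h m).compl₂ (exteriorPower.map m b)) (fun v w => ?_) x y
  simp only [LinearMap.comp_apply, LinearMap.compl₂_apply, exteriorPower.map_apply_ιMulti,
    wedgeForm_ιMulti, Function.comp_apply, hab]

theorem map_proj_apply_of_mem_plucker {π : V →ₗ[K] V} (hπ : ∀ x ∈ p, π x = x) {x : ⋀[K]^m V}
    (hx : x ∈ plucker m p) : exteriorPower.map m π x = x := by
  obtain ⟨z, rfl⟩ := hx
  rw [← LinearMap.comp_apply, ← exteriorPower.map_comp]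
  congr 2
  ext y
  exact hπ y y.2

theorem map_mem_plucker {π : V →ₗ[K] V} (hπ : ∀ x, π x ∈ p) (x : ⋀[K]^m V) :
    exteriorPower.map m π x ∈ plucker m p := by
  have : π = p.subtype ∘ₗ π.codRestrict p hπ := by ext; rfl
  rw [this, exteriorPower.map_comp]
  exact ⟨_, rfl⟩

theorem plucker_map (T : V →ₗ[K] V) :
    plucker m (p.map T) = (plucker m p).map (exteriorPower.map m T) := by
  apply le_antisymm
  · rintro _ ⟨z, rfl⟩
    have hs : Function.Surjective (T.restrict fun x hx => Submodule.mem_map_of_mem hx :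
        p →ₗ[K] p.map T) := by
      rintro ⟨_, x, hx, rfl⟩
      exact ⟨⟨x, hx⟩, rfl⟩
    obtain ⟨z, rfl⟩ := exteriorPower.map_surjective (n := m) hs z
    refine ⟨exteriorPower.map m p.subtype z, ⟨z, rfl⟩, ?_⟩
    rw [← LinearMap.comp_apply, ← LinearMap.comp_apply, ← exteriorPower.map_comp,
      ← exteriorPower.map_comp]
    rfl
  · rintro _ ⟨_, ⟨z, rfl⟩, rfl⟩
    refine ⟨exteriorPower.map m (T.restrict fun x hx => Submodule.mem_map_of_mem hx :
        p →ₗ[K] p.map T) z, ?_⟩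
    rw [← LinearMap.comp_apply, ← LinearMap.comp_apply, ← exteriorPower.map_comp,
      ← exteriorPower.map_comp]
    rfl

variable [FiniteDimensional K V]

theorem isHermitianForm_wedgeForm (hh : IsHermitianForm h) (m : ℕ) :
    IsHermitianForm (wedgeForm h m) := by
  refine ⟨wedgeForm_conj_symm hh, fun x hx => ?_⟩
  set b := Module.finBasis K V
  obtain ⟨n, c, g, hg⟩ := exists_resolution hh
  -- `w` is the `h`-dual basis of `b`; pairing with wedges of the `w j` reads off all coordinates of
  -- `x` in the exterior basis.
  let w : Fin (Module.finrank K V) → V := fun j => ∑ r, ((c r : K) * conj (b.coord j (g r))) • g r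
  have hw : ∀ j, h (w j) = b.coord j := fun j => LinearMap.ext fun y => by
    conv_rhs => rw [hg y]
    simp only [w, map_sum, LinearMap.map_smulₛₗ, LinearMap.sum_apply, LinearMap.smul_apply,
      map_mul, RCLike.conj_ofReal, RCLike.conj_conj, smul_eq_mul, map_smul]
    exact Finset.sum_congr rfl fun r _ => by ring
  refine (b.exteriorPower m).ext_elem fun s => ?_
  rw [map_zero, Finsupp.zero_apply, exteriorPower.basis_repr_apply]
  have : ∀ y, exteriorPower.ιMultiDual K m b s y = wedgeForm h m
      (exteriorPower.ιMulti K m fun i => w (Set.powersetCard.ofFinEmbEquiv.symm s i)) y := by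
    refine LinearMap.congr_fun (exteriorPower.linearMap_ext (AlternatingMap.ext fun v => ?_))
    simp only [LinearMap.compAlternatingMap_apply, wedgeForm_ιMulti, hw,
      exteriorPower.ιMultiDual_apply_ιMulti]
    rw [← Matrix.det_transpose]
    rfl
  rw [this, ← wedgeForm_conj_symm hh, hx, map_zero]

theorem finrank_plucker (hp : Module.finrank K p = k) :
    Module.finrank K (plucker m p) = k.choose m := by
  rw [plucker, LinearMap.finrank_range_of_inj
    (exteriorPower.map_injective_field p.subtype_injective), exteriorPower.finrank_eq, hp]

/-- For `x` in `⋀^m p` self-adjointness gives `⟨x, y⟩ = ⟨x, ⋀^m π y⟩`, so nondegeneracy descends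
from `⋀^m V`. -/
theorem plucker_mem_gr0 (hh : IsHermitianForm h) (hp : p ∈ Gr0 h k) :
    plucker m p ∈ Gr0 (wedgeForm h m) (k.choose m) := by
  refine ⟨finrank_plucker hp.1, fun x hx h0 =>
    (isHermitianForm_wedgeForm hh m).nondegenerate x fun y => ?_⟩
  rw [← map_proj_apply_of_mem_plucker (fun _ => proj_of_mem hh hp) hx,
    wedgeForm_map_left (form_proj_left hh hp)]
  exact h0 _ (map_mem_plucker (proj_mem hh hp) y)

theorem proj_plucker (hh : IsHermitianForm h) (hp : p ∈ Gr0 h k) :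
    proj (wedgeForm h m) (plucker m p) = exteriorPower.map m (proj h p) := by
  refine (isCompl_and_proj_eq (isHermitianForm_wedgeForm hh m)
    (plucker_mem_gr0 (m := m) hh hp).2 _ (map_mem_plucker (proj_mem hh hp)) fun x y hy => ?_).2
  change wedgeForm h m y _ = 0
  rw [map_sub, ← wedgeForm_map_left (form_proj_left hh hp),
    map_proj_apply_of_mem_plucker (fun _ => proj_of_mem hh hp) hy, sub_self]

/-- Differentiate `⟨⋀^m(1 + εs) x, y⟩ = ⟨x, ⋀^m(1 + εs^*) y⟩` at `ε = 0`. -/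
theorem adj_derivation (hh : IsHermitianForm h) (s : V →ₗ[K] V) :
    adj (wedgeForm h m) (derivation m s) = derivation m (adj h s) := by
  refine adj_eq (isHermitianForm_wedgeForm hh m) fun x y => ?_
  have e : ∀ ε : ℝ, wedgeForm h m (exteriorPower.map m (LinearMap.id + (ε : K) • s) x) y =
      wedgeForm h m x (exteriorPower.map m (LinearMap.id + (ε : K) • adj h s) y) := fun ε =>
    wedgeForm_map_left (fun x y => by
      simp [form_adj hh, Algebra.smul_def]) x y
  have h1 := (hasVelocity_map m (adj h s)).map (LinearMap.applyₗ y) (wedgeForm h m x)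
  have h2 := (hasVelocity_map m s).map (LinearMap.applyₗ x) (wedgeForm h m y)
  -- The form is conjugate-linear in its first slot, so that slot is differentiated through the
  -- conjugate of the swapped form; `ε` is real.
  have h3 := (RCLike.conjCLE (K := K)).toContinuousLinearMap.hasFDerivAt.comp_hasDerivAt (0 : ℝ) h2
  simp only [LinearMap.applyₗ_apply_apply] at h1
  have h4 : HasDerivAt (fun ε : ℝ => wedgeForm h m x
      (exteriorPower.map m (LinearMap.id + (ε : K) • adj h s) y))
      (wedgeForm h m (derivation m s x) y) 0 := by
    rw [← wedgeForm_conj_symm hh]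
    refine h3.congr_of_eventuallyEq (Filter.Eventually.of_forall fun ε => ?_)
    change _ = conj (wedgeForm h m y _)
    rw [wedgeForm_conj_symm hh]
    exact (e ε).symm
  exact h4.unique h1

theorem compress_derivation (hh : IsHermitianForm h) (hp : p ∈ Gr0 h k) (s : V →ₗ[K] V) :
    compress (wedgeForm h m) (plucker m p) (derivation m s) =
      derivation m (compress h p s) ∘ₗ exteriorPower.map m (proj h p) := by
  have hπ := proj_comp_proj hh hp
  have e : compress h p s = s ∘ₗ proj h p - proj h p ∘ₗ s ∘ₗ proj h p := by ext; rfl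
  rw [compress, proj_plucker hh hp, LinearMap.sub_comp, LinearMap.id_comp,
    map_comp_derivation_comp_map_self _ _ hπ, derivation_comp_map _ _ hπ, e, derivation_sub,
    LinearMap.sub_comp]

theorem dPlucker_eq_of_mem_tangent (hh : IsHermitianForm h) (hp : p ∈ Gr0 h k) {t : V →ₗ[K] V}
    (ht : t ∈ tangent h p) :
    dPlucker h m p t = derivation m t ∘ₗ exteriorPower.map m (proj h p) :=
  (compress_derivation hh hp t).trans (by rw [compress_of_mem_tangent hh hp ht])

theorem dPlucker_compress (hh : IsHermitianForm h) (hp : p ∈ Gr0 h k) (s : V →ₗ[K] V) :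
    dPlucker h m p (compress h p s) =
      compress (wedgeForm h m) (plucker m p) (derivation m s) := by
  rw [dPlucker_eq_of_mem_tangent hh hp (compress_mem_tangent hh hp s), compress_derivation hh hp]

theorem adj_comp (hh : IsHermitianForm h) (s t : V →ₗ[K] V) :
    adj h (s ∘ₗ t) = adj h t ∘ₗ adj h s :=
  adj_eq hh fun x y => by simp [form_adj hh]

theorem adj_proj (hh : IsHermitianForm h) (hp : p ∈ Gr0 h k) : adj h (proj h p) = proj h p :=
  adj_eq hh (form_proj_left hh hp)

theorem adj_dPlucker (hh : IsHermitianForm h) (hp : p ∈ Gr0 h k) {s : V →ₗ[K] V}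
    (hs : s ∈ tangent h p) : adj (wedgeForm h m) (dPlucker h m p s) =
      exteriorPower.map m (proj h p) ∘ₗ derivation m (adj h s) := by
  have hw := isHermitianForm_wedgeForm hh m
  rw [dPlucker_eq_of_mem_tangent hh hp hs, ← proj_plucker hh hp, adj_comp hw, adj_derivation hh,
    adj_proj hw (plucker_mem_gr0 hh hp)]

/-- Factoring `π` through `p` and using cyclicity turns this into the trace of a derivation on `⋀^m
p` itself. -/
theorem trace_derivation_comp_map_proj (hh : IsHermitianForm h) (hp : p ∈ Gr0 h k) (hm : 1 ≤ m)
    (u : V →ₗ[K] V) :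
    LinearMap.trace K _ (derivation m u ∘ₗ exteriorPower.map m (proj h p)) =
      ((k - 1).choose (m - 1) : K) * LinearMap.trace K V (u ∘ₗ proj h p) := by
  set π' : V →ₗ[K] p := (proj h p).codRestrict p (proj_mem hh hp)
  have h1 : proj h p = p.subtype ∘ₗ π' := by ext; rfl
  have h2 : π' ∘ₗ p.subtype = LinearMap.id := by
    ext x
    exact proj_of_mem hh hp x.2
  rw [h1, exteriorPower.map_comp, ← LinearMap.comp_assoc, LinearMap.trace_comp_comm',
    map_comp_derivation_comp_map _ _ h2, trace_derivation hm, hp.1,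
    LinearMap.trace_comp_comm' (u ∘ₗ p.subtype), LinearMap.comp_assoc]

theorem hermitianMetric_dPlucker (hh : IsHermitianForm h) (hp : p ∈ Gr0 h k) (hm : 1 ≤ m)
    {s t : V →ₗ[K] V} (hs : s ∈ tangent h p) (ht : t ∈ tangent h p) :
    hermitianMetric (wedgeForm h m) (dPlucker h m p s) (dPlucker h m p t) =
      ((k - 1).choose (m - 1) : K) * hermitianMetric h s t := by
  have hπ := proj_comp_proj hh hp
  obtain ⟨a1, a2⟩ := adj_mem hh hp hs
  obtain ⟨t1, t2⟩ := (mem_tangent_iff hh hp).1 ht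
  have e0 : derivation m (adj h s) ∘ₗ exteriorPower.map m (proj h p) = 0 := by
    rw [derivation_comp_map _ _ hπ, a2, derivation_zero, LinearMap.zero_comp]
  have e1 : derivation m (adj h s) ∘ₗ derivation m t ∘ₗ exteriorPower.map m (proj h p) =
      derivation m (adj h s ∘ₗ t - t ∘ₗ adj h s) ∘ₗ exteriorPower.map m (proj h p) :=
    comp_comp_of_commutator (derivation_comm _ _) e0
  -- `t s^*` dies on `p`, since `s^*` does.
  have e2 : proj h p ∘ₗ (adj h s ∘ₗ t - t ∘ₗ adj h s) ∘ₗ proj h p = adj h s ∘ₗ t := by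
    rw [LinearMap.sub_comp, LinearMap.comp_sub, LinearMap.comp_assoc, LinearMap.comp_assoc, a2, t1,
      LinearMap.comp_zero, LinearMap.comp_zero, sub_zero, ← LinearMap.comp_assoc, a1]
  rw [hermitianMetric, adj_dPlucker hh hp hs, dPlucker_eq_of_mem_tangent hh hp ht,
    LinearMap.comp_assoc, e1, map_comp_derivation_comp_map_self _ _ hπ, e2,
    trace_derivation_comp_map_proj hh hp hm, LinearMap.comp_assoc, t1, hermitianMetric]

/-- `D(s) D(t)` restricted to `⋀^m p`: the second fundamental form of the Plücker map. -/
noncomputable def secondForm (h : V →ₗ⋆[K] V →ₗ[K] K) (m : ℕ) (p : Submodule K V)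
    (t s : V →ₗ[K] V) : ⋀[K]^m V →ₗ[K] ⋀[K]^m V :=
  derivation m s ∘ₗ derivation m t ∘ₗ exteriorPower.map m (proj h p)

/-- `D(1 - π)` counts the factors in `p^⊥`; a tangent vector replaces a factor in `p` by one in
`p^⊥`. -/
theorem derivation_codegree (hh : IsHermitianForm h) (hp : p ∈ Gr0 h k) {t : V →ₗ[K] V}
    (ht : t ∈ tangent h p) :
    derivation m (LinearMap.id - proj h p) ∘ₗ derivation m t -
      derivation m t ∘ₗ derivation m (LinearMap.id - proj h p) = derivation m t := by
  obtain ⟨t1, t2⟩ := (mem_tangent_iff hh hp).1 ht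
  rw [derivation_comm, LinearMap.sub_comp, LinearMap.comp_sub, t1, t2]
  simp

theorem derivation_adj_codegree (hh : IsHermitianForm h) (hp : p ∈ Gr0 h k) {t : V →ₗ[K] V}
    (ht : t ∈ tangent h p) :
    derivation m (LinearMap.id - proj h p) ∘ₗ derivation m (adj h t) -
      derivation m (adj h t) ∘ₗ derivation m (LinearMap.id - proj h p) =
        -derivation m (adj h t) := by
  obtain ⟨t1, t2⟩ := adj_mem hh hp ht
  refine (derivation_comm _ _).trans ((congrArg _ ?_).trans (map_neg (derivationₗ K V m) (adj h t)))
  rw [LinearMap.sub_comp, LinearMap.comp_sub, t1, t2]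
  simp

theorem derivation_codegree_comp_map (hh : IsHermitianForm h) (hp : p ∈ Gr0 h k) :
    derivation m (LinearMap.id - proj h p) ∘ₗ exteriorPower.map m (proj h p) = 0 := by
  rw [derivation_comp_map _ _ (proj_comp_proj hh hp), LinearMap.sub_comp, LinearMap.id_comp,
    proj_comp_proj hh hp, sub_self, derivation_zero, LinearMap.zero_comp]

theorem map_comp_derivation_codegree (hh : IsHermitianForm h) (hp : p ∈ Gr0 h k) :
    exteriorPower.map m (proj h p) ∘ₗ derivation m (LinearMap.id - proj h p) = 0 := by
  have h2 := proj_proj hh hp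
  refine exteriorPower.linearMap_ext (AlternatingMap.ext fun v => ?_)
  simp only [LinearMap.compAlternatingMap_apply, LinearMap.comp_apply, derivation_ιMulti, map_sum,
    exteriorPower.map_apply_ιMulti, LinearMap.zero_apply]
  refine Finset.sum_eq_zero fun i _ => AlternatingMap.map_coord_zero _ i ?_
  simp [h2]

theorem map_comp_secondForm (hh : IsHermitianForm h) (hp : p ∈ Gr0 h k) {t s : V →ₗ[K] V}
    (ht : t ∈ tangent h p) (hs : s ∈ tangent h p) :
    exteriorPower.map m (proj h p) ∘ₗ secondForm h m p t s = 0 :=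
  comp_raise_raise_eq_zero (derivation_codegree hh hp hs) (derivation_codegree hh hp ht)
    (derivation_codegree_comp_map hh hp) (map_comp_derivation_codegree hh hp)

theorem secondForm_comp_map (hh : IsHermitianForm h) (hp : p ∈ Gr0 h k) (t s : V →ₗ[K] V) :
    secondForm h m p t s ∘ₗ exteriorPower.map m (proj h p) = secondForm h m p t s := by
  rw [secondForm, LinearMap.comp_assoc, LinearMap.comp_assoc, ← exteriorPower.map_comp,
    proj_comp_proj hh hp]

theorem secondForm_mem_tangent (hh : IsHermitianForm h) (hp : p ∈ Gr0 h k) {t s : V →ₗ[K] V}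
    (ht : t ∈ tangent h p) (hs : s ∈ tangent h p) :
    secondForm h m p t s ∈ tangent (wedgeForm h m) (plucker m p) := by
  rw [mem_tangent_iff (isHermitianForm_wedgeForm hh m) (plucker_mem_gr0 hh hp),
    proj_plucker hh hp]
  exact ⟨secondForm_comp_map hh hp t s, map_comp_secondForm hh hp ht hs⟩

theorem hermitianMetric_dPlucker_secondForm (hh : IsHermitianForm h) (hp : p ∈ Gr0 h k)
    {t s r : V →ₗ[K] V} (ht : t ∈ tangent h p) (hs : s ∈ tangent h p) (hr : r ∈ tangent h p) :
    hermitianMetric (wedgeForm h m) (dPlucker h m p r) (secondForm h m p t s) = 0 := by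
  have e : exteriorPower.map m (proj h p) ∘ₗ derivation m (adj h r) ∘ₗ secondForm h m p t s = 0 :=
    comp_lower_raise_raise_eq_zero (derivation_adj_codegree hh hp hr)
      (derivation_codegree hh hp hs) (derivation_codegree hh hp ht)
      (derivation_codegree_comp_map hh hp) (map_comp_derivation_codegree hh hp)
  rw [hermitianMetric, adj_dPlucker hh hp hr, LinearMap.comp_assoc, e, map_zero]

end WedgeForm

/-! ### Smooth dependence of the projector on the frame -/

section Smoothness

variable {K V W : Type*} [RCLike K] [AddCommGroup V] [Module K V] [FiniteDimensional K V]
  [AddCommGroup W] [Module K W]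
  {h : V →ₗ⋆[K] V →ₗ[K] K} {k : ℕ}
  {E : Type*} [NormedAddCommGroup E] [NormedSpace ℝ E] {Ω : Set E}

/-- The matrix coefficients of `F` are smooth on `Ω`. -/
def SmoothHomOn (Ω : Set E) (F : E → V →ₗ[K] W) : Prop :=
  ∀ (v : V) (l : W →ₗ[K] K), ContDiffOn ℝ ∞ (fun A => l (F A v)) Ω

omit [FiniteDimensional K V] in
theorem smoothHomOn_const (T : V →ₗ[K] W) : SmoothHomOn Ω fun _ => T :=
  fun _ _ => contDiffOn_const

omit [FiniteDimensional K V] in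
theorem SmoothHomOn.sub {F G : E → V →ₗ[K] W} (hF : SmoothHomOn Ω F) (hG : SmoothHomOn Ω G) :
    SmoothHomOn Ω fun A => F A - G A := fun v l => by
  simpa only [LinearMap.sub_apply, map_sub] using (hF v l).sub (hG v l)

theorem SmoothHomOn.comp {F : E → V →ₗ[K] W} {G : E → V →ₗ[K] V} (hF : SmoothHomOn Ω F)
    (hG : SmoothHomOn Ω G) : SmoothHomOn Ω fun A => F A ∘ₗ G A := fun v l => by
  set b := Module.finBasis K V
  have e : (fun A => l ((F A ∘ₗ G A) v)) =
      fun A => ∑ i, b.coord i (G A v) * l (F A (b i)) :=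
    funext fun A => linearMap_apply_eq_sum b (l ∘ₗ F A) (G A v)
  rw [e]
  exact ContDiffOn.sum fun i _ => (hG v _).mul (hF _ l)

theorem frame_repr (v : Fin k → V) :
    frame V (fun i j => (Module.finBasis K V).repr (v i) j) = v :=
  funext fun i => (Module.finBasis K V).sum_repr (v i)

theorem contDiff_frame (i : Fin k) (l : V →ₗ[K] K) : ContDiff ℝ ∞
    fun A : Fin k → Fin (Module.finrank K V) → K => l (frame V A i) := by
  simp only [frame, map_sum, map_smul, smul_eq_mul]
  fun_prop

theorem contDiff_form_frame (hh : IsHermitianForm h) (i : Fin k) (v : V) : ContDiff ℝ ∞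
    fun A : Fin k → Fin (Module.finrank K V) → K => h (frame V A i) v := by
  have e : (fun A : Fin k → Fin (Module.finrank K V) → K => h (frame V A i) v) =
      fun A => RCLike.conjCLE (K := K) (h v (frame V A i)) :=
    funext fun A => (hh.conj_symm _ _).symm
  rw [e]
  exact (RCLike.conjCLE (K := K)).contDiff.comp (contDiff_frame i (h v))

theorem contDiff_gram (hh : IsHermitianForm h) (i j : Fin k) : ContDiff ℝ ∞
    fun A : Fin k → Fin (Module.finrank K V) → K => gram h (frame V A) i j := by
  have e : (fun A : Fin k → Fin (Module.finrank K V) → K => gram h (frame V A) i j) =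
      fun A => ∑ a, A j a * h (frame V A i) (Module.finBasis K V a) :=
    funext fun A => by simp [gram, frame]
  rw [e]
  refine ContDiff.sum fun a _ => ContDiff.mul (by fun_prop) (contDiff_form_frame hh i _)

omit [FiniteDimensional K V] in
theorem contDiff_det {ι : Type*} [Fintype ι] [DecidableEq ι] {M : E → Matrix ι ι K}
    (hM : ∀ i j, ContDiff ℝ ∞ fun A => M A i j) : ContDiff ℝ ∞ fun A => (M A).det := by
  simp only [Matrix.det_apply']
  exact ContDiff.sum fun σ _ => contDiff_const.mul (contDiff_prod fun i _ => hM _ _)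

theorem contDiffOn_inv_gram (hh : IsHermitianForm h) (i j : Fin k) : ContDiffOn ℝ ∞
    (fun A : Fin k → Fin (Module.finrank K V) → K => (gram h (frame V A))⁻¹ i j)
    {A | (gram h (frame V A)).det ≠ 0} := by
  simp only [Matrix.inv_def, Matrix.smul_apply, Ring.inverse_eq_inv', smul_eq_mul,
    Matrix.adjugate_apply]
  refine ContDiffOn.mul (ContDiffOn.inv (contDiff_det (contDiff_gram hh)).contDiffOn
    fun A hA => hA) (contDiff_det fun a b => ?_).contDiffOn
  by_cases ha : a = j
  · subst ha
    simpa using contDiff_const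
  · simpa [Matrix.updateRow_ne ha] using contDiff_gram hh a b

theorem framesOver_gr0 (hh : IsHermitianForm h) :
    framesOver k (Gr0 h k) = {A | (gram h (frame V A)).det ≠ 0} :=
  Set.ext fun _ => mem_gr0_iff_of_basis_span hh _

theorem isOpenGr_gr0 (hh : IsHermitianForm h) : IsOpenGr k (Gr0 h k) := by
  rw [IsOpenGr, framesOver_gr0 hh]
  exact isOpen_ne.preimage (contDiff_det (contDiff_gram hh)).continuous

theorem smoothHomOn_proj (hh : IsHermitianForm h) : SmoothHomOn (framesOver k (Gr0 h k))
    fun A => proj h (Submodule.span K (Set.range (frame V A))) := by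
  rw [framesOver_gr0 hh]
  intro v l
  have e : ∀ A ∈ {A : Fin k → Fin (Module.finrank K V) → K | (gram h (frame V A)).det ≠ 0},
      l (proj h (Submodule.span K (Set.range (frame V A))) v) =
        ∑ i, (∑ j, (gram h (frame V A))⁻¹ i j * h (frame V A j) v) * l (frame V A i) := by
    intro A hA
    rw [(isCompl_and_proj_span_eq hh _ hA).2, gramProj_apply]
    simp
  refine ContDiffOn.congr ?_ e
  exact ContDiffOn.sum fun i _ => ContDiffOn.mul (ContDiffOn.sum fun j _ =>
    (contDiffOn_inv_gram hh i j).mul (contDiff_form_frame hh j v).contDiffOn)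
    (contDiff_frame i l).contDiffOn

/-- Supplies a field on all of `Gr0` through any prescribed tangent vector, to serve as a test field
for uniqueness. -/
theorem isTangentField_compress (hh : IsHermitianForm h) (s : V →ₗ[K] V) :
    IsTangentField h k (Gr0 h k) fun q => compress h q s where
  subset := subset_rfl
  isOpen := isOpenGr_gr0 hh
  mem_tangent _ hq := compress_mem_tangent hh hq s
  smooth := ((smoothHomOn_const _).sub (smoothHomOn_proj hh)).comp
    ((smoothHomOn_const s).comp (smoothHomOn_proj hh))

end Smoothness

/-! ### The grassmannian topology through projectors, and the homeomorphism onto the image -/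

section Topology

variable {K V : Type*} [RCLike K] [AddCommGroup V] [Module K V] [FiniteDimensional K V]
  {h : V →ₗ⋆[K] V →ₗ[K] K} {k m : ℕ}

/-- The matrix of the orthogonal projector onto `p`. -/
noncomputable def projMatrix (h : V →ₗ⋆[K] V →ₗ[K] K) (p : Submodule K V) :
    Matrix (Fin (Module.finrank K V)) (Fin (Module.finrank K V)) K :=
  LinearMap.toMatrix (Module.finBasis K V) (Module.finBasis K V) (proj h p)

/-- The topology of the grassmannian is induced by `p ↦ proj h p`. -/
theorem isOpenGr_iff (hh : IsHermitianForm h) {O : Set (Submodule K V)} (hO : O ⊆ Gr0 h k) :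
    IsOpenGr k O ↔ ∃ U, IsOpen U ∧ O = {p | p ∈ Gr0 h k ∧ projMatrix h p ∈ U} := by
  set b := Module.finBasis K V
  constructor
  · intro hopen
    -- `Ψ A M` is the frame `A` moved by the matrix `M`. For `M` the projector onto `p` the moved
    -- frame lies in `p`, and if still independent it spans `p` by dimension.
    let Ψ : (Fin k → Fin (Module.finrank K V) → K) → Matrix (Fin (Module.finrank K V))
        (Fin (Module.finrank K V)) K → Fin k → Fin (Module.finrank K V) → K :=
      fun A M i j => b.repr (Matrix.toLin b b M (frame V A i)) j
    have hΨ : ∀ A, Continuous (Ψ A) := fun A => continuous_pi fun i => continuous_pi fun j =>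
      (b.coord j ∘ₗ LinearMap.applyₗ (frame V A i) ∘ₗ
        (Matrix.toLin b b).toLinearMap).continuous_of_finiteDimensional
    refine ⟨⋃ A ∈ framesOver k O, Ψ A ⁻¹' framesOver k O,
      isOpen_biUnion fun A _ => hopen.preimage (hΨ A), Set.ext fun p => ⟨fun hp => ?_, ?_⟩⟩
    · obtain ⟨a, hli, rfl, -⟩ := exists_frame_of_mem_gr0 hh (hO hp)
      refine ⟨hO hp, Set.mem_iUnion₂.2 ⟨fun i j => b.repr (a i) j, ?_, ?_⟩⟩
      · rw [framesOver, Set.mem_ofPred_eq, frame_repr]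
        exact ⟨hli, hp⟩
      · have : Ψ (fun i j => b.repr (a i) j) (projMatrix h (Submodule.span K (Set.range a))) =
            fun i j => b.repr (a i) j := by
          funext i j
          simp only [Ψ, projMatrix, b, frame_repr, Matrix.toLin_toMatrix]
          rw [proj_of_mem hh (hO hp) (Submodule.subset_span ⟨i, rfl⟩)]
        rw [Set.mem_preimage, this, framesOver, Set.mem_ofPred_eq, frame_repr]
        exact ⟨hli, hp⟩
    · rintro ⟨hp, hU⟩
      obtain ⟨A, -, hA⟩ := Set.mem_iUnion₂.1 hU
      have e : frame V (Ψ A (projMatrix h p)) = fun i => proj h p (frame V A i) := by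
        simp only [Ψ, projMatrix, Matrix.toLin_toMatrix, b]
        exact frame_repr _
      rw [Set.mem_preimage, framesOver, Set.mem_ofPred_eq, e] at hA
      have hle : Submodule.span K (Set.range fun i => proj h p (frame V A i)) ≤ p :=
        Submodule.span_le.2 (by rintro _ ⟨i, rfl⟩; exact proj_mem hh hp _)
      rw [← Submodule.eq_of_le_of_finrank_eq hle ((hO hA.2).1.trans hp.1.symm)]
      exact hA.2
  · rintro ⟨U, hU, rfl⟩
    have hc : ContinuousOn (fun A : Fin k → Fin (Module.finrank K V) → K =>
        projMatrix h (Submodule.span K (Set.range (frame V A)))) (framesOver k (Gr0 h k)) :=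
      continuousOn_pi.2 fun i => continuousOn_pi.2 fun j => by
        simp only [projMatrix, LinearMap.toMatrix_apply]
        exact (smoothHomOn_proj hh (b j) (b.coord i)).continuousOn
    have e : framesOver k {p | p ∈ Gr0 h k ∧ projMatrix h p ∈ U} = framesOver k (Gr0 h k) ∩
        (fun A => projMatrix h (Submodule.span K (Set.range (frame V A)))) ⁻¹' U := by
      ext A
      simp only [framesOver, Set.mem_ofPred_eq, Set.mem_inter_iff, Set.mem_preimage, and_assoc]
    rw [IsOpenGr, e]
    exact hc.isOpen_inter_preimage (isOpenGr_gr0 hh) hU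

/-- From `tr(D(u) ⋀^m π) = c tr(u π)` with `u` a matrix unit one reads off each entry of `π`. The
constant `c` is nonzero because `m ≤ k`. -/
theorem exists_continuous_recover (hh : IsHermitianForm h) (hm : 1 ≤ m) (hmk : m ≤ k) :
    ∃ F : Matrix (Fin (Module.finrank K (⋀[K]^m V))) (Fin (Module.finrank K (⋀[K]^m V))) K →
        Matrix (Fin (Module.finrank K V)) (Fin (Module.finrank K V)) K,
      Continuous F ∧
        ∀ p ∈ Gr0 h k, F (projMatrix (wedgeForm h m) (plucker m p)) = projMatrix h p := by
  set b := Module.finBasis K V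
  set B := Module.finBasis K (⋀[K]^m V)
  set c : K := ((k - 1).choose (m - 1) : K)
  have hc : c ≠ 0 := Nat.cast_ne_zero.2 (Nat.choose_pos (by omega)).ne'
  refine ⟨fun M => Matrix.of fun i j => c⁻¹ * LinearMap.trace K _
    (derivation m ((b.coord i).smulRight (b j)) ∘ₗ Matrix.toLin B B M), ?_, fun p hp => ?_⟩
  · refine continuous_pi fun i => continuous_pi fun j => continuous_const.mul ?_
    exact (LinearMap.trace K _ ∘ₗ LinearMap.llcomp K _ _ _
      (derivation m ((b.coord i).smulRight (b j))) ∘ₗ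
        (Matrix.toLin B B).toLinearMap).continuous_of_finiteDimensional
  · ext i j
    have e : (b.coord i).smulRight (b j) ∘ₗ proj h p =
        (b.coord i ∘ₗ proj h p).smulRight (b j) := rfl
    simp only [projMatrix, Matrix.of_apply, B, Matrix.toLin_toMatrix, proj_plucker hh hp]
    rw [trace_derivation_comp_map_proj hh hp hm, e, LinearMap.trace_smulRight,
      inv_mul_cancel_left₀ hc, LinearMap.toMatrix_apply]
    rfl

theorem continuous_toMatrix_map (m : ℕ) : Continuous
    fun M : Matrix (Fin (Module.finrank K V)) (Fin (Module.finrank K V)) K =>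
      LinearMap.toMatrix (Module.finBasis K (⋀[K]^m V)) (Module.finBasis K (⋀[K]^m V))
        (exteriorPower.map m (Matrix.toLin (Module.finBasis K V) (Module.finBasis K V) M)) := by
  set b := Module.finBasis K V
  have key : ∀ (l : ⋀[K]^m V →ₗ[K] K) (x : ⋀[K]^m V), Continuous
      fun M => l (exteriorPower.map m (Matrix.toLin b b M) x) := by
    intro l x
    induction x using exteriorPower_induction with
    | ιMulti v =>
      have h1 : Continuous fun (M : Matrix (Fin (Module.finrank K V)) (Fin (Module.finrank K V)) K)
          (i : Fin m) (j : Fin (Module.finrank K V)) => b.repr (Matrix.toLin b b M (v i)) j :=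
        continuous_pi fun i => continuous_pi fun j =>
          (b.coord j ∘ₗ LinearMap.applyₗ (v i) ∘ₗ
            (Matrix.toLin b b).toLinearMap).continuous_of_finiteDimensional
      refine ((continuous_multilinearMap_coords b (l.compMultilinearMap
        (exteriorPower.ιMulti K m (M := V)).toMultilinearMap)).comp h1).congr fun M => ?_
      simp only [Function.comp_def, Module.Basis.sum_repr, exteriorPower.map_apply_ιMulti]
      rfl
    | zero => simpa using continuous_const
    | add x y hx hy => simp only [map_add]; exact hx.add hy
    | smul a x hx => simp only [map_smul]; exact hx.const_smul a
  refine continuous_pi fun i => continuous_pi fun j => ?_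
  simp only [LinearMap.toMatrix_apply]
  exact key ((Module.finBasis K (⋀[K]^m V)).coord i) _

theorem injOn_plucker (hh : IsHermitianForm h) (hm : 1 ≤ m) (hmk : m ≤ k) :
    Set.InjOn (plucker m) (Gr0 h k) := by
  obtain ⟨F, -, hF⟩ := exists_continuous_recover hh hm hmk
  intro p hp q hq hpq
  refine proj_injOn hh hp hq ((LinearMap.toMatrix (Module.finBasis K V)
    (Module.finBasis K V)).injective ?_)
  change projMatrix h p = projMatrix h q
  rw [← hF p hp, ← hF q hq, hpq]

theorem isOpenGr_iff_plucker (hh : IsHermitianForm h) (hm : 1 ≤ m) (hmk : m ≤ k)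
    {O : Set (Submodule K V)} (hO : O ⊆ Gr0 h k) :
    IsOpenGr k O ↔ ∃ O' ⊆ Gr0 (wedgeForm h m) (k.choose m), IsOpenGr (k.choose m) O' ∧
      O = {p | p ∈ Gr0 h k ∧ plucker m p ∈ O'} := by
  have hw := isHermitianForm_wedgeForm hh m
  rw [isOpenGr_iff hh hO]
  constructor
  · rintro ⟨U, hU, rfl⟩
    obtain ⟨F, hF, hF'⟩ := exists_continuous_recover hh hm hmk
    have hs : {q | q ∈ Gr0 (wedgeForm h m) (k.choose m) ∧
      projMatrix (wedgeForm h m) q ∈ F ⁻¹' U} ⊆ Gr0 (wedgeForm h m) (k.choose m) := fun q hq => hq.1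
    refine ⟨_, hs, (isOpenGr_iff hw hs).2 ⟨_, hU.preimage hF, rfl⟩, Set.ext fun p =>
      and_congr_right fun hp => ?_⟩
    rw [Set.mem_ofPred_eq, Set.mem_preimage, hF' p hp]
    exact (and_iff_right (plucker_mem_gr0 hh hp)).symm
  · rintro ⟨O', hO', hopen, rfl⟩
    obtain ⟨U, hU, rfl⟩ := (isOpenGr_iff hw hO').1 hopen
    refine ⟨_, hU.preimage (continuous_toMatrix_map m), Set.ext fun p =>
      and_congr_right fun hp => ?_⟩
    rw [Set.mem_ofPred_eq, and_iff_right (plucker_mem_gr0 hh hp), Set.mem_preimage, projMatrix,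
      projMatrix, proj_plucker hh hp, Matrix.toLin_toMatrix]

end Topology

/-! ### The Gauss formula -/

section Gauss

variable {K V : Type*} [RCLike K] [AddCommGroup V] [Module K V] [FiniteDimensional K V]
  {h : V →ₗ⋆[K] V →ₗ[K] K} {p : Submodule K V} {k m : ℕ}

theorem hasDerivAt_coords {v : Fin k → ℝ → V} {v' : Fin k → V}
    (hv : ∀ i, HasVelocity K (v i) (v' i)) :
    HasDerivAt (fun ε => fun i j => (Module.finBasis K V).repr (v i ε) j)
      (fun i j => (Module.finBasis K V).repr (v' i) j) 0 :=
  hasDerivAt_pi.2 fun i => hasDerivAt_pi.2 fun j => hv i ((Module.finBasis K V).coord j)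

theorem eventually_span_mem {O : Set (Submodule K V)} (hO : IsOpenGr k O) {a : Fin k → V}
    (hli : LinearIndependent K a) (ha : Submodule.span K (Set.range a) ∈ O) {v : Fin k → ℝ → V}
    {v' : Fin k → V} (h0 : ∀ i, v i 0 = a i) (hv : ∀ i, HasVelocity K (v i) (v' i)) :
    ∀ᶠ ε in nhds (0 : ℝ), Submodule.span K (Set.range fun i => v i ε) ∈ O := by
  have h1 := (hasDerivAt_coords hv).continuousAt
  have h2 : (fun i j => (Module.finBasis K V).repr (v i 0) j) ∈ framesOver k O := by
    simp only [framesOver, Set.mem_ofPred_eq, frame_repr, h0]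
    exact ⟨hli, ha⟩
  filter_upwards [h1.preimage_mem_nhds (hO.mem_nhds h2)] with ε hε
  have h3 := hε.2
  rwa [frame_repr] at h3

/-- A smooth function on the grassmannian has a derivative along a curve, which depends on the
velocities of a moving frame only. -/
theorem exists_hasDerivAt_span {O : Set (Submodule K V)} (hO : IsOpenGr k O)
    {F : Submodule K V → K}
    (hF : ContDiffOn ℝ ∞ (fun A : Fin k → Fin (Module.finrank K V) → K =>
      F (Submodule.span K (Set.range (frame V A)))) (framesOver k O)) {a : Fin k → V}
    (hli : LinearIndependent K a) (ha : Submodule.span K (Set.range a) ∈ O) (v' : Fin k → V) :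
    ∃ d : K, ∀ v : Fin k → ℝ → V, (∀ i, v i 0 = a i) → (∀ i, HasVelocity K (v i) (v' i)) →
      HasDerivAt (fun ε => F (Submodule.span K (Set.range fun i => v i ε))) d 0 := by
  set b := Module.finBasis K V
  have h2 : (fun i j => b.repr (a i) j) ∈ framesOver k O := by
    simp only [framesOver, Set.mem_ofPred_eq, b, frame_repr]
    exact ⟨hli, ha⟩
  have hd := ((hF.contDiffAt (hO.mem_nhds h2)).differentiableAt (by simp)).hasFDerivAt
  refine ⟨fderiv ℝ (fun A : Fin k → Fin (Module.finrank K V) → K =>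
      F (Submodule.span K (Set.range (frame V A)))) (fun i j => b.repr (a i) j)
      fun i j => b.repr (v' i) j, fun v h0 hv => ?_⟩
  have h3 : (fun i j => b.repr (v i 0) j) = fun i j => b.repr (a i) j := by simp only [h0]
  refine (hd.comp_hasDerivAt_of_eq (0 : ℝ) (hasDerivAt_coords hv) h3.symm).congr_of_eventuallyEq
    (Filter.Eventually.of_forall fun ε => ?_)
  simp only [Function.comp_def, frame_repr]

omit [FiniteDimensional K V] in
theorem map_span_range (T : V →ₗ[K] V) (a : Fin k → V) :
    (Submodule.span K (Set.range a)).map T = Submodule.span K (Set.range fun i => T (a i)) := by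
  rw [Submodule.map_span, ← Set.range_comp]
  rfl

omit [FiniteDimensional K V] in
theorem compress_eq_add {T A S : V →ₗ[K] V} (hT : ∀ x, T (proj h p x) = A (proj h p x) + S x)
    (hS : ∀ x, proj h p (S x) = 0) : compress h p T = compress h p A + S := by
  ext x
  rw [LinearMap.add_apply, compress_apply, compress_apply, hT, map_add, hS, add_zero]
  abel

omit [FiniteDimensional K V] in
theorem map_id_add_zero (t : V →ₗ[K] V) :
    p.map (LinearMap.id + ((0 : ℝ) : K) • t) = p := by
  simp

/-- On vectors of `⋀^m q` the projector in the differential acts trivially, so `Y` is just `D(X(q))`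
there and no projector has to be differentiated. -/
theorem gauss_formula (hh : IsHermitianForm h) (hp : p ∈ Gr0 h k)
    {O : Set (Submodule K V)} {X : Submodule K V → V →ₗ[K] V}
    {O' : Set (Submodule K (⋀[K]^m V))} {Y : Submodule K (⋀[K]^m V) → ⋀[K]^m V →ₗ[K] ⋀[K]^m V}
    (hX : IsTangentField h k O X) (hY : IsTangentField (wedgeForm h m) (k.choose m) O' Y)
    (hpO : p ∈ O) (hXY : ∀ q ∈ O, plucker m q ∈ O' ∧ Y (plucker m q) = dPlucker h m q (X q))
    {t : V →ₗ[K] V} (ht : t ∈ tangent h p) :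
    nabla (wedgeForm h m) (plucker m p) (dPlucker h m p t) Y =
      dPlucker h m p (nabla h p t X) + secondForm h m p t (X p) := by
  have hw := isHermitianForm_wedgeForm hh m
  have hpm := plucker_mem_gr0 (m := m) hh hp
  have hEt : ∀ w ∈ plucker m p, dPlucker h m p t w = derivation m t w := fun w hw => by
    rw [dPlucker_eq_of_mem_tangent hh hp ht, LinearMap.comp_apply,
      map_proj_apply_of_mem_plucker (fun _ => proj_of_mem hh hp) hw]
  have hPt : ∀ w ∈ plucker m p, exteriorPower.map m (proj h p) (derivation m t w) = 0 := by
    intro w hw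
    obtain ⟨t1, t2⟩ := (mem_tangent_iff hh hp).1 ht
    have e := LinearMap.congr_fun
      (map_comp_derivation_comp_map_self (m := m) t _ (proj_comp_proj hh hp)) w
    rw [LinearMap.comp_apply, LinearMap.comp_apply,
      map_proj_apply_of_mem_plucker (fun _ => proj_of_mem hh hp) hw] at e
    rw [e, t1, t2, derivation_zero]
    rfl
  set q : ℝ → Submodule K V := fun ε => p.map (LinearMap.id + (ε : K) • t) with hq
  set Q : ℝ → Submodule K (⋀[K]^m V) := fun ε =>
    (plucker m p).map (LinearMap.id + (ε : K) • dPlucker h m p t) with hQ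
  have hq0 : q 0 = p := map_id_add_zero t
  -- the derivative of `X` along `q`
  obtain ⟨a, hli, hspan, -⟩ := exists_frame_of_mem_gr0 hh hp
  have hqa : ∀ ε, q ε = Submodule.span K (Set.range fun i => a i + (ε : K) • t (a i)) := fun ε => by
    simp only [hq]
    rw [← hspan, map_span_range]
    rfl
  have ha0 : ∀ i, a i + ((0 : ℝ) : K) • t (a i) = a i := fun i => by simp
  have hav : ∀ i, HasVelocity K (fun ε : ℝ => a i + (ε : K) • t (a i)) (t (a i)) := fun i =>
    hasVelocity_affine _ _
  have hqO : ∀ᶠ ε in nhds (0 : ℝ), q ε ∈ O := by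
    filter_upwards [eventually_span_mem hX.isOpen hli (hspan.symm ▸ hpO) ha0 hav] with ε hε
    rwa [hqa]
  have hXv : HasVelocity K (fun ε => X (q ε)) (velocity (K := K) fun ε => X (q ε)) := by
    refine hasVelocity_velocity_of_apply fun v l => ?_
    obtain ⟨d, hd⟩ := exists_hasDerivAt_span (F := fun q => l (X q v)) hX.isOpen (hX.smooth v l)
      hli (hspan.symm ▸ hpO) fun i => t (a i)
    simp only [hqa]
    exact (hd _ ha0 hav).differentiableAt
  -- the derivative of `Y` along `Q` and along the image of `q`
  obtain ⟨β, hβli, hβ, -⟩ := exists_frame_of_mem_gr0 hw hpm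
  have hβm : ∀ i, β i ∈ plucker m p := fun i => hβ ▸ Submodule.subset_span ⟨i, rfl⟩
  have hQβ : ∀ ε, Q ε = Submodule.span K
      (Set.range fun i => β i + (ε : K) • derivation m t (β i)) := fun ε => by
    simp only [hQ]
    rw [← hβ, map_span_range]
    simp only [LinearMap.add_apply, LinearMap.id_apply, LinearMap.smul_apply, hEt _ (hβm _)]
  have hqβ : ∀ ε, plucker m (q ε) = Submodule.span K
      (Set.range fun i => exteriorPower.map m (LinearMap.id + (ε : K) • t) (β i)) := fun ε => by
    simp only [hq]
    rw [plucker_map, ← hβ, map_span_range]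
  -- `nabla` follows the curve `Q`, whereas `Y` is tied to `X` only along `⋀^m q`. Both curves have
  -- frames starting at `β` with velocities `D(t) β_i`, hence the same derivative `d`.
  have hYd : ∀ (v : ⋀[K]^m V) (l : ⋀[K]^m V →ₗ[K] K), ∃ d : K, HasDerivAt (fun ε => l (Y (Q ε) v)) d 0 ∧
      HasDerivAt (fun ε => l (Y (plucker m (q ε)) v)) d 0 := by
    intro v l
    obtain ⟨d, hd⟩ := exists_hasDerivAt_span (F := fun q => l (Y q v)) hY.isOpen (hY.smooth v l)
      hβli (hβ.symm ▸ (hXY p hpO).1) fun i => derivation m t (β i)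
    refine ⟨d, ?_, ?_⟩
    · simp only [hQβ]
      exact hd _ (fun i => by simp) fun i => hasVelocity_affine _ _
    · simp only [hqβ]
      refine hd (fun i ε => exteriorPower.map m (LinearMap.id + (ε : K) • t) (β i))
        (fun i => by simp) fun i => (hasVelocity_map m t).map (LinearMap.applyₗ (β i))
  set Y' := velocity (K := K) fun ε => Y (Q ε) with hY'
  have hYQ : HasVelocity K (fun ε => Y (Q ε)) Y' :=
    hasVelocity_velocity_of_apply fun v l => (hYd v l).choose_spec.1.differentiableAt
  have hYq : HasVelocity K (fun ε => Y (plucker m (q ε))) Y' := by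
    refine HasVelocity.of_apply fun v l => ?_
    obtain ⟨d, h1, h2⟩ := hYd v l
    have e : l (Y' v) = d := (hYQ (l ∘ₗ LinearMap.applyₗ v)).unique h1
    rw [e]
    exact h2
  -- differentiate `Y (w ε) = D (X) (w ε)` for a curve `w ε` in the image of `q ε`
  have key : ∀ w ∈ plucker m p, Y' w =
      derivation m (velocity (K := K) fun ε => X (q ε)) w +
        derivation m (X p) (derivation m t w) := by
    intro w hwp
    have hwv : HasVelocity K (fun ε : ℝ => exteriorPower.map m (LinearMap.id + (ε : K) • t) w)
      (derivation m t w) := (hasVelocity_map m t).map (LinearMap.applyₗ w)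
    have h1 := hYq.apply hwv
    have h2 := (hXv.map (derivationₗ K V m)).apply hwv
    have h3 := h2.unique (h1.congr ?_)
    · simp only [derivationₗ_apply, hq0, (hXY p hpO).2, RCLike.ofReal_zero, zero_smul, add_zero,
        exteriorPower.map_id, LinearMap.id_apply] at h3
      -- The product-rule term `Y(⋀^m p)(D(t) w)` vanishes: `Y(⋀^m p)` factors through `⋀^m π`,
      -- which kills `D(t) w`.
      rw [h3, dPlucker_eq_of_mem_tangent hh hp (hX.mem_tangent p hpO), LinearMap.comp_apply,
        hPt w hwp, map_zero, add_zero]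
    · filter_upwards [hqO] with ε hε
      have hqε := hX.subset hε
      have hmem : exteriorPower.map m (LinearMap.id + (ε : K) • t) w ∈ plucker m (q ε) := by
        simp only [hq, plucker_map]
        exact Submodule.mem_map_of_mem hwp
      rw [(hXY _ hε).2, dPlucker_eq_of_mem_tangent hh hqε (hX.mem_tangent _ hε),
        LinearMap.comp_apply, map_proj_apply_of_mem_plucker (fun _ => proj_of_mem hh hqε) hmem]
      rfl
  have hP := proj_plucker (m := m) hh hp
  rw [nabla, nabla, dPlucker_compress hh hp]
  refine compress_eq_add (fun x => ?_) fun x => ?_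
  · rw [hP]
    exact key _ (map_mem_plucker (proj_mem hh hp) x)
  · rw [hP]
    exact LinearMap.congr_fun (map_comp_secondForm hh hp ht (hX.mem_tangent p hpO)) x

end Gauss

/-! ### Existence, uniqueness and tracelessness of the second fundamental form -/

section SecondFundamentalForm

variable {K V : Type*} [RCLike K] [AddCommGroup V] [Module K V]
  [FiniteDimensional K V] {h : V →ₗ⋆[K] V →ₗ[K] K} {p : Submodule K V} {k m : ℕ}

omit [FiniteDimensional K V] in
theorem metric_add_right (s t u : V →ₗ[K] V) :
    metric h s (t + u) = metric h s t + metric h s u := by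
  simp [metric, hermitianMetric, LinearMap.comp_add]

omit [FiniteDimensional K V] in
theorem metric_smul_right (s t : V →ₗ[K] V) (r : ℝ) :
    metric h s ((r : K) • t) = r * metric h s t := by
  simp [metric, hermitianMetric, LinearMap.comp_smul]

theorem dPlucker_add (hh : IsHermitianForm h) (hp : p ∈ Gr0 h k) {s t : V →ₗ[K] V}
    (hs : s ∈ tangent h p) (ht : t ∈ tangent h p) :
    dPlucker h m p (s + t) = dPlucker h m p s + dPlucker h m p t := by
  rw [dPlucker_eq_of_mem_tangent hh hp hs, dPlucker_eq_of_mem_tangent hh hp ht,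
    dPlucker_eq_of_mem_tangent hh hp (Submodule.add_mem _ hs ht), derivation_add,
    LinearMap.add_comp]

theorem metric_dPlucker (hh : IsHermitianForm h) (hp : p ∈ Gr0 h k) (hm : 1 ≤ m)
    {s t : V →ₗ[K] V} (hs : s ∈ tangent h p) (ht : t ∈ tangent h p) :
    metric (wedgeForm h m) (dPlucker h m p s) (dPlucker h m p t) =
      ((k - 1).choose (m - 1) : ℝ) * metric h s t := by
  rw [metric, hermitianMetric_dPlucker hh hp hm hs ht, ← RCLike.ofReal_natCast,
    RCLike.re_ofReal_mul]
  rfl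

variable [Module ℝ V] [IsScalarTower ℝ K V]

omit [FiniteDimensional K V] in
theorem coe_smul_tangent (r : ℝ) (t : tangent h p) :
    ((r • t : tangent h p) : V →ₗ[K] V) = (r : K) • (t : V →ₗ[K] V) := by
  rw [Submodule.coe_smul_of_tower, RCLike.real_smul_eq_coe_smul (K := K)]

/-- `secondForm` as a bilinear map on the tangent space. -/
noncomputable def secondFormBilin (h : V →ₗ⋆[K] V →ₗ[K] K) (m : ℕ) (p : Submodule K V) :
    tangent h p →ₗ[ℝ] tangent h p →ₗ[ℝ] (⋀[K]^m V →ₗ[K] ⋀[K]^m V) :=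
  LinearMap.mk₂ ℝ (fun t s => secondForm h m p t s)
    (fun t t' s => by
      simp only [secondForm, Submodule.coe_add, derivation_add, LinearMap.add_comp,
        LinearMap.comp_add])
    (fun r t s => by
      rw [RCLike.real_smul_eq_coe_smul (K := K) r (secondForm h m p t s)]
      simp only [secondForm, coe_smul_tangent, derivation_smul, LinearMap.smul_comp,
        LinearMap.comp_smul])
    (fun t s s' => by
      simp only [secondForm, Submodule.coe_add, derivation_add, LinearMap.add_comp])
    (fun r t s => by
      rw [RCLike.real_smul_eq_coe_smul (K := K) r (secondForm h m p t s)]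
      simp only [secondForm, coe_smul_tangent, derivation_smul, LinearMap.smul_comp])

theorem isSecondFundamentalForm_secondFormBilin (hh : IsHermitianForm h) (hp : p ∈ Gr0 h k) :
    IsSecondFundamentalForm h k m p (secondFormBilin h m p) where
  mem_tangent t s := secondForm_mem_tangent hh hp t.2 s.2
  normal t s r := by
    change metric _ _ (secondForm h m p t s) = 0
    rw [metric, hermitianMetric_dPlucker_secondForm hh hp t.2 s.2 r.2, map_zero]
  gauss_formula O X O' Y hX hY hpO hXY t s hs :=
    ⟨⟨_, compress_mem_tangent hh hp _⟩, by
      rw [gauss_formula hh hp hX hY hpO hXY t.2, hs]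
      rfl⟩

theorem IsSecondFundamentalForm.unique (hh : IsHermitianForm h) (hp : p ∈ Gr0 h k) (hm : 1 ≤ m)
    (hmk : m ≤ k) {B B' : tangent h p →ₗ[ℝ] tangent h p →ₗ[ℝ] (⋀[K]^m V →ₗ[K] ⋀[K]^m V)}
    (hB : IsSecondFundamentalForm h k m p B) (hB' : IsSecondFundamentalForm h k m p B') :
    B' = B := by
  refine LinearMap.ext₂ fun t s => ?_
  have hX := isTangentField_compress (k := k) hh (s : V →ₗ[K] V)
  have hY := isTangentField_compress (k := k.choose m) (isHermitianForm_wedgeForm hh m)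
    (derivation m (s : V →ₗ[K] V))
  have hXY : ∀ q ∈ Gr0 h k, plucker m q ∈ Gr0 (wedgeForm h m) (k.choose m) ∧
      compress (wedgeForm h m) (plucker m q) (derivation m (s : V →ₗ[K] V)) =
        dPlucker h m q (compress h q s) := fun q hq =>
    ⟨plucker_mem_gr0 hh hq, (dPlucker_compress hh hq _).symm⟩
  have hs : compress h p (s : V →ₗ[K] V) = s := compress_of_mem_tangent hh hp s.2
  obtain ⟨r, hr⟩ := hB.gauss_formula _ _ _ _ hX hY hp hXY t s hs
  obtain ⟨r', hr'⟩ := hB'.gauss_formula _ _ _ _ hX hY hp hXY t s hs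
  have e1 : (r : V →ₗ[K] V) = (r - r' : tangent h p) + (r' : V →ₗ[K] V) := by simp
  rw [hr', e1, dPlucker_add hh hp (r - r').2 r'.2, add_comm (dPlucker h m p _) (dPlucker h m p r'),
    add_assoc] at hr
  -- The two candidates differ by the image of `r - r'`, which is also normal; the metric being
  -- nondegenerate and the scaling constant nonzero, `r - r' = 0`.
  have e2 := LinearMap.ext fun x => add_left_cancel (LinearMap.congr_fun hr x)
  have e3 : ((r - r' : tangent h p) : V →ₗ[K] V) = 0 := by
    refine tangent_eq_zero_of_metric hh hp (r - r').2 fun u hu => ?_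
    have h1 := hB'.normal t s ⟨u, hu⟩
    rw [e2, metric_add_right, hB.normal, add_zero, metric_dPlucker hh hp hm hu (r - r').2] at h1
    rw [metric_comm hh]
    exact (mul_eq_zero.1 h1).resolve_left
      (Nat.cast_ne_zero.2 (Nat.choose_pos (by omega)).ne')
  rw [e2, e3, dPlucker_eq_of_mem_tangent hh hp (Submodule.zero_mem _), derivation_zero,
    LinearMap.zero_comp, zero_add]

omit [Module ℝ V] [IsScalarTower ℝ K V] in
theorem secondForm_smulRight_self (φ : V →ₗ[K] K) (f : V) (hf : φ f = 0) :
    secondForm h m p (φ.smulRight f) (φ.smulRight f) = 0 := by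
  rw [secondForm, ← LinearMap.comp_assoc, derivation_comp_derivation_smulRight φ f hf,
    LinearMap.zero_comp]

theorem traceVanishes_secondFormBilin (hh : IsHermitianForm h) (hp : p ∈ Gr0 h k) :
    TraceVanishes h p (secondFormBilin h m p) := by
  intro d b b' hbb'
  obtain ⟨ι, _, c, φ, f, h1, h2, h3⟩ := exists_rank_one_family hh hp
  set B := secondFormBilin h m p
  let u : ι → tangent h p := fun j => ⟨(φ j).smulRight (f j), h1 j⟩
  have hu : ∀ x : tangent h p, x = ∑ j, (c j * metric h (u j) x) • u j := fun x => by
    apply Subtype.ext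
    conv_lhs => rw [h3 x x.2]
    simp only [u, Submodule.coe_sum, coe_smul_tangent]
  -- Expansion in the dual bases. Together with `hu` it replaces `∑ B(b_i, b'_i)` by `∑ c_j B(u_j,
  -- u_j)`.
  have hb : ∀ x : tangent h p, ∑ i, metric h x (b i) • b' i = x := fun x => by
    have e : ∀ i, metric h x (b i) = b'.repr x i := fun i => by
      have : metric h (b i) x = metric h (b i)
          ((∑ j, b'.repr x j • b' j : tangent h p) : V →ₗ[K] V) := by rw [b'.sum_repr]
      rw [metric_comm hh, this]
      let g : (V →ₗ[K] V) →+ ℝ := ⟨⟨metric h (b i), by simp [metric, hermitianMetric]⟩,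
        metric_add_right _⟩
      change g _ = _
      rw [Submodule.coe_sum, map_sum]
      simp only [coe_smul_tangent]
      change ∑ j, metric h (b i) _ = _
      simp only [metric_smul_right, hbb', mul_ite, mul_one, mul_zero, Finset.sum_ite_eq,
        Finset.mem_univ, if_true]
    simp only [e, b'.sum_repr]
  have hBu : ∀ j, B (u j) (u j) = 0 := fun j => secondForm_smulRight_self _ _ (h2 j)
  calc ∑ i, B (b i) (b' i)
      = ∑ i, ∑ j, (c j * metric h (u j) (b i)) • B (u j) (b' i) := by
        refine Finset.sum_congr rfl fun i _ => ?_
        conv_lhs => rw [hu (b i)]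
        simp only [map_sum, map_smul, LinearMap.sum_apply, LinearMap.smul_apply]
    _ = ∑ j, c j • B (u j) (∑ i, metric h (u j) (b i) • b' i) := by
        rw [Finset.sum_comm]
        simp only [map_sum, map_smul, Finset.smul_sum, mul_smul]
    _ = 0 := by simp only [hb, hBu, smul_zero, Finset.sum_const_zero]

end SecondFundamentalForm

end Plucker

theorem corollary2p11 {K V : Type*} [RCLike K] [AddCommGroup V] [Module K V]
    [FiniteDimensional K V] [Module ℝ V] [IsScalarTower ℝ K V]
    (h : V →ₗ⋆[K] V →ₗ[K] K) (hh : Plucker.IsHermitianForm h)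
    (k m : ℕ) (hm : 1 ≤ m) (hmk : m ≤ k) :
    -- the target is a grassmannian of a space with a nondegenerate hermitian form
    Plucker.IsHermitianForm (Plucker.wedgeForm h m) ∧
    Set.MapsTo (Plucker.plucker m) (Plucker.Gr0 h k)
      (Plucker.Gr0 (Plucker.wedgeForm h m) (k.choose m)) ∧
    -- the map is injective and a homeomorphism onto its image
    Set.InjOn (Plucker.plucker m) (Plucker.Gr0 h k) ∧
    (∀ O ⊆ Plucker.Gr0 h k, Plucker.IsOpenGr k O ↔
      ∃ O' ⊆ Plucker.Gr0 (Plucker.wedgeForm h m) (k.choose m),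
        Plucker.IsOpenGr (k.choose m) O' ∧
          O = {p | p ∈ Plucker.Gr0 h k ∧ Plucker.plucker m p ∈ O'}) ∧
    ∀ p ∈ Plucker.Gr0 h k,
      -- the metric is nondegenerate and the map is isometric up to a positive constant
      (∀ s ∈ Plucker.tangent h p,
        (∀ t ∈ Plucker.tangent h p, Plucker.metric h s t = 0) → s = 0) ∧
      (∀ s ∈ Plucker.tangent h p, ∀ t ∈ Plucker.tangent h p,
        Plucker.hermitianMetric (Plucker.wedgeForm h m) (Plucker.dPlucker h m p s)
            (Plucker.dPlucker h m p t) =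
          ((k - 1).choose (m - 1) : K) * Plucker.hermitianMetric h s t) ∧
      -- the second fundamental form exists, is unique, and is traceless
      ∃ B : Plucker.tangent h p →ₗ[ℝ] Plucker.tangent h p →ₗ[ℝ] (⋀[K]^m V →ₗ[K] ⋀[K]^m V),
        Plucker.IsSecondFundamentalForm h k m p B ∧
        (∀ B', Plucker.IsSecondFundamentalForm h k m p B' → B' = B) ∧
        Plucker.TraceVanishes h p B := by
  refine ⟨Plucker.isHermitianForm_wedgeForm hh m, fun p hp => Plucker.plucker_mem_gr0 hh hp,
    Plucker.injOn_plucker hh hm hmk, fun O hO => Plucker.isOpenGr_iff_plucker hh hm hmk hO,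
    fun p hp => ⟨fun s hs h0 => Plucker.tangent_eq_zero_of_metric hh hp hs h0,
      fun s hs t ht => Plucker.hermitianMetric_dPlucker hh hp hm hs ht,
      Plucker.secondFormBilin h m p, Plucker.isSecondFundamentalForm_secondFormBilin hh hp,
      fun B' hB' => (Plucker.isSecondFundamentalForm_secondFormBilin hh hp).unique hh hp hm hmk hB',
      Plucker.traceVanishes_secondFormBilin hh hp⟩⟩
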